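/- Let $G$ be a locally compact second countable (lcsc) Hausdorff group. \textbf{Definitions.} A \emph{local $G$-space} is a Hausdorff lcsc space $M$ with a continuous map $\alpha:\mathrm{dom}(\alpha)\to M$, $\alpha(p,g)=p.g$, where $\mathrm{dom}(\alpha)\subset M\times G$ is open, such that for all $p\in M$: (1) $p.1_G$ is defined and equals $p$; (2) if $p.g$ is defined then $(p.g).g^{-1}$ is defined and equals $p$; (3) if $p.g$, $(p.g).h$ and $p.gh$ are defined then $p.gh=(p.g).h$; (4) there is an open neighborhood $O$ of $1_G$ such that $g\mapsto p.g$ is defined on $O$ and is a homeomorphism from $O$ onto an open neighborhood of $p$ (then $p.O\to O$, $p.g\mapsto g$, is called a chart centered at $p$). Fix a left Haar measure on $G$. The canonical measure $\mathrm{vol}_M$ is the unique Borel (in fact Radon) measure on $M$ with $\mathrm{vol}_M(K)=\mathrm{Haar}_G(\{g\in O: p.g\in K\})$ whenever $O$ is the range of a chart centered at $p$ and $K\subset p.O$ is Borel. For $U\subset G$ open and pre-compact, $M[U]$ is the set of $p\in M$ such that $p.g.h=p.gh$ (both sides being defined) whenever $g,h,gh\in U$, and such that $g\mapsto p.g$ is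 a homeomorphism from $U$ onto an open neighborhood of $p$. For $\epsilon>0$, $M$ is a \emph{$(U,\epsilon)$-sofic approximation to $G$} if $\mathrm{vol}_M(M)<\infty$ and $\mathrm{vol}_M(M[U])\ge(1-\epsilon)\mathrm{vol}_M(M)$. A \emph{sofic approximation to $G$} is a sequence $(M_i)$ of local $G$-spaces, all but finitely many of them nonempty, such that $M_i$ is a $(U_i,\epsilon_i)$-sofic approximation for some pre-compact open sets $U_i$ increasing to $G$ and some $\epsilon_i>0$ decreasing to $0$. $G$ is \emph{sofic} if it admits a sofic approximation. A \emph{lattice} in $G$ is a subgroup $\Gamma\le G$ that is discrete in the induced topology and such that $\Gamma\backslash G$ has a nonzero finite $G$-invariant Borel measure. A \emph{fundamental domain} for $\Gamma$ is a Borel set $\Delta\subset G$ such that $G=\bigsqcup_{\gamma\in\Gamma}\gamma\Delta$ is a partition; we call it \emph{locally finite} if the family $(\gamma\Delta)_{\gamma\in\Gamma}$ is locally finite in $G$. \textbf{Induced spaces.} Let $\Delta$ be a fundamental domain for $\Gamma$, let $\sigma:\Gamma\backslash G\to\Delta$ be the section with $\Gamma\sigma(\Gamma h)=\Gamma h$,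 and let $c(\Gamma h,g)=\sigma(\Gamma h)\,g\,\sigma(\Gamma hg)^{-1}\in\Gamma$. For a local $\Gamma$-space $V$ and $(v,\Gamma h)\in V\times\Gamma\backslash G$, $g\in G$, put $(v,\Gamma h).g=(v.c(\Gamma h,g),\Gamma hg)$, which is defined if and only if $v.c(\Gamma h,g)$ is. A set $O\subset G$ is \emph{good} for $p\in V\times\Gamma\backslash G$ if it is an open neighborhood of $1_G$, $p.h_1$ and $p.h_1.h_1^{-1}h_2$ are defined for all $h_1,h_2\in O$, and $g\mapsto p.g$ is injective on $O$. Let $\mathrm{Ind}_\Gamma^G(V)$ (which depends on $\Delta$) be the set of all $p\in V\times\Gamma\backslash G$ that have a good set, with the topology generated by the sets $p.O$ with $O$ good for $p$, and with the partial action $(p,g)\mapsto p.g$ whose domain is the set of all $(p,g)\in\mathrm{Ind}_\Gamma^G(V)\times G$ having an open neighborhood at every point $(q,f)$ of which $q.f$ is defined and lies in $\mathrm{Ind}_\Gamma^G(V)$. \textbf{Theorem.} Let $G$ be a Hausdorff lcsc group and let $\Gamma\le G$ be a lattice. If $\Gamma$ is sofic then $G$ is sofic. Moreover, locally finite fundamental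 domains for $\Gamma$ exist, and for every such $\Delta$ and every sofic approximation $\Sigma=(V_i)_i$ to $\Gamma$, the spaces $\mathrm{Ind}_\Gamma^G(V_i)$ formed with $\Delta$ are local $G$-spaces, and $\mathrm{Ind}_\Gamma^G(\Sigma)=(\mathrm{Ind}_\Gamma^G(V_i))_i$ is a sofic approximation to $G$. -/

import Mathlib

open Set Filter Topology MeasureTheory
open scoped Pointwise

universe u v

noncomputable section

/-- The data of a partial right action of `G` on a topological space: a space together with a
partially defined map `act`.  The set `act.Dom ⊆ carrier × G` is the domain of the action, and
`q ∈ act (p, g)` says that `p.g` is defined and equal to `q`. No axioms are imposed here. -/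
structure PartialSpace (G : Type u) where
  carrier : Type v
  top : TopologicalSpace carrier
  act : carrier × G →. carrier

attribute [instance] PartialSpace.top

namespace PartialSpace

variable {G : Type u} [Group G] [TopologicalSpace G]

/-- `g ↦ p.g` is defined on all of `U` and is a homeomorphism from `U` onto an open
neighbourhood of `p`. -/
def IsHomeoOntoNhd (M : PartialSpace.{u, v} G) (p : M.carrier) (U : Set G) : Prop :=
  ∃ h : ∀ g ∈ U, (M.act (p, g)).Dom,
    IsOpenEmbedding (fun g : U => (M.act (p, (g : G))).get (h g g.2)) ∧
      p ∈ range (fun g : U => (M.act (p, (g : G))).get (h g g.2))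

/-- `O` is the range of a chart centered at `p`; the chart itself is the inverse of the
homeomorphism `g ↦ p.g` from `O` onto `p.O`. -/
def IsChart (M : PartialSpace.{u, v} G) (p : M.carrier) (O : Set G) : Prop :=
  IsOpen O ∧ (1 : G) ∈ O ∧ M.IsHomeoOntoNhd p O

/-- `M` is a local `G`-space: a Hausdorff locally compact second countable space with a partial
homogeneous right action of `G`. -/
structure IsLocalSpace (M : PartialSpace.{u, v} G) : Prop where
  hausdorff : T2Space M.carrier
  locallyCompact : LocallyCompactSpace M.carrier
  secondCountable : SecondCountableTopology M.carrier
  isOpen_dom : IsOpen M.act.Dom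
  continuous_act : Continuous M.act.asSubtype
  one_act : ∀ p, p ∈ M.act (p, 1)
  act_inv : ∀ p g q, q ∈ M.act (p, g) → p ∈ M.act (q, g⁻¹)
  act_mul : ∀ p g h q r s, q ∈ M.act (p, g) → r ∈ M.act (q, h) → s ∈ M.act (p, g * h) → s = r
  homogeneous : ∀ p, ∃ O : Set G, M.IsChart p O

/-- The characterization of the canonical Borel measure on a local `G`-space, relative to a left
Haar measure `η` on `G`: for every chart with range `O` centered at `p` and every Borel set
`K ⊆ p.O` the measure of `K` is `η {g ∈ O | p.g ∈ K}`.  (On a local `G`-space there is exactly one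
such measure; it is locally finite, hence Radon.) -/
def IsCanonicalMeasure [MeasurableSpace G] (M : PartialSpace.{u, v} G)
    [MeasurableSpace M.carrier] (η : Measure G) (vol : Measure M.carrier) : Prop :=
  ∀ (p : M.carrier) (O : Set G), M.IsChart p O →
    ∀ K : Set M.carrier, MeasurableSet K → (∀ q ∈ K, ∃ g ∈ O, q ∈ M.act (p, g)) →
      vol K = η {g | g ∈ O ∧ ∃ q ∈ K, q ∈ M.act (p, g)}

/-- The set `M[U]` of points at which the partial action looks like `G` acting on itself, as far
as `U` can see. -/
def goodPoints (M : PartialSpace.{u, v} G) (U : Set G) : Set M.carrier :=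
  {p | (∀ g h : G, g ∈ U → h ∈ U → g * h ∈ U →
        ∃ q r, q ∈ M.act (p, g) ∧ r ∈ M.act (q, h) ∧ r ∈ M.act (p, g * h)) ∧
      M.IsHomeoOntoNhd p U}

/-- The local `G`-space `M` is a `(U, ε)`-sofic approximation to `G`. The condition does not depend
on the normalization of the Haar measure `η`. -/
def IsSoficApprox (M : PartialSpace.{u, v} G) (U : Set G) (ε : ℝ) : Prop :=
  letI : MeasurableSpace G := borel G
  letI : MeasurableSpace M.carrier := borel M.carrier
  M.IsLocalSpace ∧
    ∃ (η : Measure G) (vol : Measure M.carrier),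
      η.IsHaarMeasure ∧ M.IsCanonicalMeasure η vol ∧ vol univ < ⊤ ∧
        ENNReal.ofReal (1 - ε) * vol univ ≤ vol (M.goodPoints U)

end PartialSpace

/-- The sequence `M` of local `G`-spaces is a sofic approximation to `G`. All but finitely many of
the spaces have to be nonempty, since the empty space is a `(U, ε)`-sofic approximation to every
group. -/
def IsSoficApproximation {G : Type u} [Group G] [TopologicalSpace G]
    (M : ℕ → PartialSpace.{u, v} G) : Prop :=
  (∀ᶠ i in atTop, Nonempty (M i).carrier) ∧
    ∃ (U : ℕ → Set G) (ε : ℕ → ℝ),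
      (∀ i, IsOpen (U i)) ∧ (∀ i, IsCompact (closure (U i))) ∧ Monotone U ∧ (⋃ i, U i) = univ ∧
      (∀ i, 0 < ε i) ∧ Antitone ε ∧ Tendsto ε atTop (𝓝 0) ∧
      ∀ i, (M i).IsSoficApprox (U i) (ε i)

/-- `G` is sofic: it admits a sofic approximation. -/
def IsSofic (G : Type u) [Group G] [TopologicalSpace G] : Prop :=
  ∃ M : ℕ → PartialSpace.{u, u} G, IsSoficApproximation M

section Lattice

variable {G : Type u} [Group G]

/-- The space `Γ \ G` of right cosets `Γ g`, with the quotient topology when `G` has a topology. -/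
abbrev RightCosets (Γ : Subgroup G) : Type u := Quotient (QuotientGroup.rightRel Γ)

namespace RightCosets

variable {Γ : Subgroup G}

/-- The coset `Γ g`. -/
def mk (g : G) : RightCosets Γ := Quotient.mk _ g

theorem mk_eq_mk {a b : G} : (mk a : RightCosets Γ) = mk b ↔ b * a⁻¹ ∈ Γ := by
  unfold mk
  rw [Quotient.eq, QuotientGroup.rightRel_apply]

/-- The right action of `G` on `Γ \ G`: `(Γ h) g = Γ (h g)`. -/
def mul (x : RightCosets Γ) (g : G) : RightCosets Γ :=
  Quotient.lift (fun h => mk (h * g)) (by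
    intro a b hab
    have hab' : b * a⁻¹ ∈ Γ := QuotientGroup.rightRel_apply.mp hab
    exact mk_eq_mk.mpr (by simpa [mul_assoc] using hab')) x

@[simp] theorem mk_mul (h g : G) : (mk h : RightCosets Γ).mul g = mk (h * g) := rfl

end RightCosets

/-- `Γ` is a lattice in `G`: it is discrete in the induced topology, and `Γ \ G` carries a
(nonzero) finite `G`-invariant Borel measure. -/
structure IsLatticeSubgroup [TopologicalSpace G] (Γ : Subgroup G) : Prop where
  discrete : DiscreteTopology Γ
  finite_invariant_measure :
    letI : MeasurableSpace (RightCosets Γ) := borel (RightCosets Γ)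
    ∃ μ : Measure (RightCosets Γ), μ ≠ 0 ∧ μ univ < ⊤ ∧
      ∀ g : G, μ.map (fun x => x.mul g) = μ

/-- A fundamental domain for `Γ`: a Borel set whose translates by elements of `Γ` form a partition
of `G`. -/
structure FundamentalDomain [TopologicalSpace G] (Γ : Subgroup G) where
  carrier : Set G
  borel_measurable : MeasurableSet[borel G] carrier
  cover : (⋃ γ : Γ, (γ : G) • carrier) = univ
  disjoint : Pairwise fun γ γ' : Γ => Disjoint ((γ : G) • carrier) ((γ' : G) • carrier)

namespace FundamentalDomain

variable [TopologicalSpace G] {Γ : Subgroup G} (Δ : FundamentalDomain Γ)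

/-- The translates of the fundamental domain form a locally finite family of subsets of `G`. -/
def IsLocallyFinite : Prop := LocallyFinite fun γ : Γ => (γ : G) • Δ.carrier

theorem exists_rep (x : RightCosets Γ) : ∃ d ∈ Δ.carrier, RightCosets.mk d = x := by
  induction x using Quotient.inductionOn with
  | h g =>
    have hg : g ∈ ⋃ γ : Γ, (γ : G) • Δ.carrier := by rw [Δ.cover]; exact mem_univ g
    obtain ⟨γ, d, hd, rfl⟩ := mem_iUnion.mp hg
    refine ⟨d, hd, RightCosets.mk_eq_mk.mpr ?_⟩
    simp

/-- The section `σ : Γ \ G → Δ`, so that `Γ σ(x) = x`. -/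
def sec (x : RightCosets Γ) : G := Classical.choose (Δ.exists_rep x)

theorem mk_sec (x : RightCosets Γ) : RightCosets.mk (Δ.sec x) = x :=
  (Classical.choose_spec (Δ.exists_rep x)).2

/-- The cocycle `c(x, g) = σ(x) g σ(x g)⁻¹ ∈ Γ`. -/
def cocycle (x : RightCosets Γ) (g : G) : Γ :=
  ⟨Δ.sec x * g * (Δ.sec (x.mul g))⁻¹, by
    rw [← RightCosets.mk_eq_mk, Δ.mk_sec, ← RightCosets.mk_mul, Δ.mk_sec]⟩

variable (V : PartialSpace.{u, v} Γ)

/-- The partially defined map `(v, x).g = (v.c(x, g), x g)` on `V × Γ \ G`, defined if and only if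
`v.c(x, g)` is. -/
def preAct : (V.carrier × RightCosets Γ) × G →. V.carrier × RightCosets Γ := fun y =>
  (V.act (y.1.1, Δ.cocycle y.1.2 y.2)).map fun w => (w, y.1.2.mul y.2)

/-- `O` is good for `p`: it is an open neighbourhood of the identity, `p.h₁` and
`p.h₁.(h₁⁻¹ h₂)` are defined for all `h₁, h₂ ∈ O`, and `g ↦ p.g` is injective on `O`. -/
structure IsGood (p : V.carrier × RightCosets Γ) (O : Set G) : Prop where
  isOpen : IsOpen O
  one_mem : (1 : G) ∈ O
  defined : ∀ h₁ ∈ O, ∀ h₂ ∈ O, ∃ q ∈ Δ.preAct V (p, h₁), (Δ.preAct V (q, h₁⁻¹ * h₂)).Dom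
  injective : ∀ g₁ ∈ O, ∀ g₂ ∈ O, ∀ q, q ∈ Δ.preAct V (p, g₁) → q ∈ Δ.preAct V (p, g₂) → g₁ = g₂

/-- The set of all points of `V × Γ \ G` which admit a good set. -/
abbrev IndCarrier : Type (max u v) :=
  {p : V.carrier × RightCosets Γ // ∃ O : Set G, Δ.IsGood V p O}

/-- The topology (not the subspace topology of the product) whose basic open sets are the
sets `p.O` with `O` good for `p`. -/
@[reducible] def indTopology : TopologicalSpace (Δ.IndCarrier V) :=
  TopologicalSpace.generateFrom
    {S | ∃ (p : V.carrier × RightCosets Γ) (O : Set G), Δ.IsGood V p O ∧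
      S = {m : Δ.IndCarrier V | ∃ g ∈ O, m.1 ∈ Δ.preAct V (p, g)}}

/-- The map `(v, x).g = (v.c(x, g), x g)`, as a partially defined map from `IndCarrier × G` to
`IndCarrier`. -/
def indPreAct : Δ.IndCarrier V × G →. Δ.IndCarrier V := fun y =>
  ⟨∃ n : Δ.IndCarrier V, n.1 ∈ Δ.preAct V (y.1.1, y.2), fun h => Classical.choose h⟩

/-- The space induced from `V` by means of the fundamental domain `Δ`: the points of `V × Γ \ G`
admitting a good set, retopologized, with the partial action whose domain is the set of all
`(p, g)` having an open neighbourhood on which `(v, x).g = (v.c(x, g), x g)` is defined as a map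
into the space. -/
def ind : PartialSpace.{u, max u v} G :=
  letI : TopologicalSpace (Δ.IndCarrier V) := Δ.indTopology V
  { carrier := Δ.IndCarrier V
    top := Δ.indTopology V
    act := (Δ.indPreAct V).restrict
      (interior_subset : interior (Δ.indPreAct V).Dom ⊆ (Δ.indPreAct V).Dom) }

end FundamentalDomain

end Lattice

end

/-! A local space `V` of the discrete group `Γ` is a discrete set; in a sofic approximation its
canonical measure is finite and a positive multiple of counting measure, so `V` is finite. The
induced space consists of those points of `V × Γ \ G ≅ V × Δ` that have a good set. An element `g`
moves `d ∈ Δ` to the `e ∈ Δ` with `d g = γ e`, and moves `V` by `γ = c(Γd, g)`. The cocycle identity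
turns the axioms for `V` into the algebraic axioms for this action. If `O` is good for `p`, then
`p.g.(g⁻¹h) = p.h` for `g, h ∈ O`, and `g⁻¹O` is good for `p.g`. Hence the sets `p.O` form a basis,
`O → p.O` is a chart, and `p` is a good point for `O`. The canonical measure restricts to Haar
measure on each slice `{v} × Δ`, because cutting a chart domain according to the cocycle and
left-translating the pieces fills the slices.

For soficity take `K` compact with `Δ ∩ K` of almost full measure in `Δ`, and `U` precompact. By
local finiteness `K U` meets only finitely many translates `γΔ`, say those with `γ ∈ F`. If `W`
contains `F ∪ F⁻¹F` and `v ∈ V[W]`, then `U` is good for `(v, Γd)` for all `d ∈ Δ ∩ K`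
(`isGood_of_mem_goodPoints`). The proportion of good points is therefore at least `(1 - ε)(1 - δ)`,
and a diagonal choice lets `U` and `K` grow along the sequence.

Total volume is finite because `Δ` has finite Haar measure (`measure_carrier_lt_top`). The invariant
measure on `Γ \ G` lifts to a right invariant measure on `G` giving `Δ` finite mass. The modular
function is trivial on `Γ`, and its logarithm on representatives is a function on `Γ \ G` shifted by
a constant by each `g`. On a finite invariant measure such a shift must vanish, so `G` is unimodular
and the lift is a Haar measure. -/

namespace RightCosets

/-! ### Topology of the coset space `Γ \ G`. -/

variable {G : Type u} [Group G] {Γ : Subgroup G}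

theorem mul_one (x : RightCosets Γ) : x.mul 1 = x := by
  induction x using Quotient.inductionOn with
  | h g => exact (mk_mul g 1).trans (by rw [_root_.mul_one]; rfl)

theorem mul_mul (x : RightCosets Γ) (g h : G) : (x.mul g).mul h = x.mul (g * h) := by
  induction x using Quotient.inductionOn with
  | h a =>
    change ((mk a).mul g).mul h = (mk a).mul (g * h)
    simp [mul_assoc]

theorem mk_surjective : Function.Surjective (mk : G → RightCosets Γ) := Quotient.mk_surjective

theorem mk_subgroup_mul (γ : Γ) (g : G) : (mk ((γ : G) * g) : RightCosets Γ) = mk g :=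
  mk_eq_mk.mpr (by simp)

theorem exists_mul_eq_of_mk_eq {a b : G} (h : (mk a : RightCosets Γ) = mk b) :
    ∃ γ : Γ, (γ : G) * a = b :=
  ⟨⟨b * a⁻¹, mk_eq_mk.mp h⟩, by simp⟩

theorem preimage_mk_image (s : Set G) :
    (mk : G → RightCosets Γ) ⁻¹' (mk '' s) = ⋃ γ : Γ, (γ : G) • s := by
  ext g
  simp only [mem_preimage, mem_image, mem_iUnion, mem_smul_set, smul_eq_mul]
  constructor
  · rintro ⟨a, ha, h⟩
    obtain ⟨γ, hγ⟩ := exists_mul_eq_of_mk_eq h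
    exact ⟨γ, a, ha, hγ⟩
  · rintro ⟨γ, a, ha, rfl⟩
    exact ⟨a, ha, (mk_subgroup_mul γ a).symm⟩

variable [TopologicalSpace G]

theorem continuous_mk : Continuous (mk : G → RightCosets Γ) := continuous_quotient_mk'

theorem isOpenQuotientMap_mk [IsTopologicalGroup G] :
    IsOpenQuotientMap (mk : G → RightCosets Γ) where
  surjective := mk_surjective
  continuous := continuous_mk
  isOpenMap := fun s hs => by
    rw [← isQuotientMap_quotient_mk'.isOpen_preimage]
    change IsOpen ((mk : G → RightCosets Γ) ⁻¹' (mk '' s))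
    rw [preimage_mk_image]
    exact isOpen_iUnion fun γ => hs.smul _

theorem continuous_mul_right [IsTopologicalGroup G] (g : G) :
    Continuous fun x : RightCosets Γ => x.mul g :=
  Continuous.quotient_lift (continuous_mk.comp (continuous_mul_const g)) _

section

variable [IsTopologicalGroup G]

theorem t2Space [T2Space G] [DiscreteTopology Γ] : T2Space (RightCosets Γ) := by
  rw [t2Space_iff_of_isOpenQuotientMap isOpenQuotientMap_mk]
  have h : IsClosed (Γ : Set G) := Γ.isClosed_of_discrete
  have : {q : G × G | (mk q.1 : RightCosets Γ) = mk q.2} =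
      (fun q : G × G => q.2 * q.1⁻¹) ⁻¹' (Γ : Set G) := by
    ext q
    simp [mk_eq_mk]
  rw [this]
  exact h.preimage (by fun_prop)

theorem locallyCompactSpace [LocallyCompactSpace G] : LocallyCompactSpace (RightCosets Γ) :=
  isOpenQuotientMap_mk.locallyCompactSpace

theorem secondCountableTopology [SecondCountableTopology G] :
    SecondCountableTopology (RightCosets Γ) :=
  isOpenQuotientMap_mk.isQuotientMap.secondCountableTopology isOpenQuotientMap_mk.isOpenMap

end

end RightCosets

theorem Subgroup.finite_coe_mem_of_isCompact {G : Type u} [Group G] [TopologicalSpace G]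
    [IsTopologicalGroup G] [T2Space G] (Γ : Subgroup G) [DiscreteTopology Γ] {K : Set G}
    (hK : IsCompact K) : {γ : Γ | (γ : G) ∈ K}.Finite :=
  ((Γ.isClosed_of_discrete.isClosedEmbedding_subtypeVal).isCompact_preimage hK).finite_of_discrete

/-! ### The section and its cocycle. -/

namespace FundamentalDomain

variable {G : Type u} [Group G] [TopologicalSpace G] {Γ : Subgroup G} (Δ : FundamentalDomain Γ)

theorem sec_mem (x : RightCosets Γ) : Δ.sec x ∈ Δ.carrier :=
  (Classical.choose_spec (Δ.exists_rep x)).1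

theorem eq_one_of_mul_mem {γ : Γ} {d e : G} (hd : d ∈ Δ.carrier) (he : e ∈ Δ.carrier)
    (h : (γ : G) * d = e) : γ = 1 := by
  by_contra hne
  refine (disjoint_left.mp (Δ.disjoint hne)) (a := e) ⟨d, hd, h⟩ ⟨e, he, ?_⟩
  simp

theorem sec_mk {d : G} (hd : d ∈ Δ.carrier) : Δ.sec (RightCosets.mk d) = d := by
  obtain ⟨γ, hγ⟩ := RightCosets.exists_mul_eq_of_mk_eq (Δ.mk_sec (RightCosets.mk d))
  have := Δ.eq_one_of_mul_mem (Δ.sec_mem _) hd hγ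
  simpa [this] using hγ

theorem sec_injective : Function.Injective Δ.sec := fun x y h => by
  rw [← Δ.mk_sec x, h, Δ.mk_sec]

theorem sec_mul (x : RightCosets Γ) (g : G) :
    Δ.sec x * g = Δ.cocycle x g * Δ.sec (x.mul g) := by
  simp [cocycle]

theorem mul_eq_mk (x : RightCosets Γ) (g : G) : x.mul g = RightCosets.mk (Δ.sec x * g) := by
  rw [← RightCosets.mk_mul, Δ.mk_sec]

theorem coe_cocycle (x : RightCosets Γ) (g : G) :
    (Δ.cocycle x g : G) = Δ.sec x * g * (Δ.sec (x.mul g))⁻¹ := rfl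

theorem cocycle_mul (x : RightCosets Γ) (g h : G) :
    Δ.cocycle x (g * h) = Δ.cocycle x g * Δ.cocycle (x.mul g) h := by
  ext
  simp [coe_cocycle, RightCosets.mul_mul, mul_assoc]

theorem cocycle_one (x : RightCosets Γ) : Δ.cocycle x 1 = 1 := by
  ext
  simp [coe_cocycle, RightCosets.mul_one]

theorem cocycle_inv (x : RightCosets Γ) (g : G) :
    Δ.cocycle (x.mul g) g⁻¹ = (Δ.cocycle x g)⁻¹ := by
  rw [eq_inv_iff_mul_eq_one, mul_eq_one_comm, ← cocycle_mul, mul_inv_cancel, cocycle_one]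

/-- If `σ(x) g ∈ γ Δ`, then `γ = c(x, g)`. -/
theorem cocycle_eq_of_mul_eq {x : RightCosets Γ} {g e : G} {γ : Γ} (he : e ∈ Δ.carrier)
    (h : Δ.sec x * g = γ * e) : Δ.cocycle x g = γ ∧ Δ.sec (x.mul g) = e := by
  have h1 : Δ.sec (x.mul g) = e := by
    rw [Δ.mul_eq_mk, h, RightCosets.mk_subgroup_mul, Δ.sec_mk he]
  refine ⟨?_, h1⟩
  ext
  rw [coe_cocycle, h1, h, mul_inv_cancel_right]

end FundamentalDomain

/-! ### Existence of locally finite fundamental domains. -/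

namespace FundamentalDomain

variable {G : Type u} [Group G] [TopologicalSpace G] [IsTopologicalGroup G]

/-- By continuity of `(x, y) ↦ y x⁻¹`, two points close to `a` differ by an element near `1`, where
discreteness leaves only `1` in `Γ`. -/
theorem exists_nhds_injOn_mk (Γ : Subgroup G) [DiscreteTopology Γ] (a : G) :
    ∃ U ∈ 𝓝 a, InjOn (RightCosets.mk : G → RightCosets Γ) U := by
  obtain ⟨N, hN, hN1⟩ : ∃ N ∈ 𝓝 (1 : G), ∀ γ ∈ Γ, γ ∈ N → γ = 1 := by
    have h : ({1} : Set Γ) ∈ 𝓝 (1 : Γ) := isOpen_discrete _ |>.mem_nhds rfl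
    rw [nhds_subtype_eq_comap] at h
    obtain ⟨N, hN, h⟩ := h
    exact ⟨N, hN, fun γ hγ hγN => congrArg Subtype.val (h (a := ⟨γ, hγ⟩) hγN)⟩
  have hc : Tendsto (fun q : G × G => q.2 * q.1⁻¹) (𝓝 (a, a)) (𝓝 1) := by
    have : Continuous fun q : G × G => q.2 * q.1⁻¹ := by fun_prop
    simpa using this.tendsto (a, a)
  have h := hc hN
  rw [nhds_prod_eq, mem_map, mem_prod_same_iff] at h
  obtain ⟨U, hU, h⟩ := h
  refine ⟨U, hU, fun x hx y hy hxy => ?_⟩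
  have := hN1 _ (RightCosets.mk_eq_mk.mp hxy) (h (mk_mem_prod hx hy))
  exact (mul_inv_eq_one.mp this).symm

variable [T2Space G] [LocallyCompactSpace G] [SecondCountableTopology G]

/-- `Γ \ G` has a locally finite countable cover by images of relatively compact open sets on which
the quotient map is injective. -/
theorem exists_locallyFinite_cover (Γ : Subgroup G) [DiscreteTopology Γ] :
    ∃ (ι : Type u) (_ : Countable ι) (U : ι → Set G), (∀ a, IsOpen (U a)) ∧
      (∀ a, IsCompact (closure (U a))) ∧
      (∀ a, InjOn (RightCosets.mk : G → RightCosets Γ) (U a)) ∧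
      (⋃ a, (RightCosets.mk : G → RightCosets Γ) '' U a) = univ ∧
      LocallyFinite fun a => (RightCosets.mk : G → RightCosets Γ) '' U a := by
  have := RightCosets.t2Space (Γ := Γ)
  have := RightCosets.locallyCompactSpace (Γ := Γ)
  have := RightCosets.secondCountableTopology (Γ := Γ)
  have hB : ∀ x : RightCosets Γ, (𝓝 x).HasBasis
      (fun U : Set G => x ∈ (RightCosets.mk : G → RightCosets Γ) '' U ∧ IsOpen U ∧
        IsCompact (closure U) ∧ InjOn (RightCosets.mk : G → RightCosets Γ) U)
      (fun U : Set G => (RightCosets.mk : G → RightCosets Γ) '' U) := by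
    intro x
    refine ⟨fun N => ⟨fun hN => ?_, ?_⟩⟩
    · obtain ⟨a, rfl⟩ := RightCosets.mk_surjective x
      obtain ⟨W, hW, hinj⟩ := exists_nhds_injOn_mk Γ a
      obtain ⟨K, hK, hKa⟩ := exists_compact_mem_nhds a
      have hN' := RightCosets.continuous_mk.continuousAt hN
      obtain ⟨U, hUs, hU, haU⟩ := mem_nhds_iff.mp (inter_mem (inter_mem hN' hW) hKa)
      refine ⟨U, ⟨mem_image_of_mem _ haU, hU, hK.closure_of_subset fun y hy => (hUs hy).2,
        hinj.mono fun y hy => (hUs hy).1.2⟩, ?_⟩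
      rintro _ ⟨y, hy, rfl⟩
      exact (hUs hy).1.1
    · rintro ⟨U, ⟨hx, hU, -, -⟩, hUN⟩
      exact mem_of_superset ((RightCosets.isOpenQuotientMap_mk.isOpenMap U hU).mem_nhds hx) hUN
  obtain ⟨ι, c, r, hp, hcov, hfin⟩ :=
    refinement_of_locallyCompact_sigmaCompact_of_nhds_basis hB
  refine ⟨ι, ?_, r, fun a => (hp a).2.1, fun a => (hp a).2.2.1, fun a => (hp a).2.2.2, hcov, hfin⟩
  -- A locally finite family of nonempty sets in a σ-compact space is countable.
  exact countable_univ_iff.mp (hfin.countable_univ fun a => ⟨c a, (hp a).1⟩)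

/-- Enumerate the cover and keep in each `U a` the points whose coset no earlier set reaches: the
least index fixes `a`, and injectivity on `U a` fixes the point. A compact `K` meets the images of
finitely many `U a`, and for each of these `γ` lies in the finite set `Γ ∩ K (closure (U a))⁻¹`. -/
theorem exists_isLocallyFinite (Γ : Subgroup G) [DiscreteTopology Γ] :
    ∃ Δ : FundamentalDomain Γ, Δ.IsLocallyFinite := by
  obtain ⟨ι, _, U, hU, hUc, hinj, hcov, hfin⟩ := exists_locallyFinite_cover Γ
  obtain ⟨e, he⟩ := Countable.exists_injective_nat ι
  let P : ι → Set G := fun a => (RightCosets.mk : G → RightCosets Γ) ⁻¹' (RightCosets.mk '' U a)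
  have hP : ∀ a, IsOpen (P a) := fun a =>
    (RightCosets.isOpenQuotientMap_mk.isOpenMap _ (hU a)).preimage RightCosets.continuous_mk
  let D : Set G := ⋃ a, U a \ ⋃ (b) (_ : e b < e a), P b
  have hD : MeasurableSet[borel G] D := by
    let _ : MeasurableSpace G := borel G
    have : BorelSpace G := ⟨rfl⟩
    refine MeasurableSet.iUnion fun a => (hU a).measurableSet.diff ?_
    exact (isOpen_iUnion fun b => isOpen_iUnion fun _ => hP b).measurableSet
  refine ⟨⟨D, hD, ?_, ?_⟩, ?_⟩
  · refine eq_univ_of_forall fun g => ?_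
    have hne : ∃ n, ∃ a, e a = n ∧ g ∈ P a := by
      have : (RightCosets.mk g : RightCosets Γ) ∈ ⋃ a, (RightCosets.mk : G → RightCosets Γ) '' U a := by
        rw [hcov]; trivial
      obtain ⟨a, ha⟩ := mem_iUnion.mp this
      exact ⟨e a, a, rfl, ha⟩
    classical
    obtain ⟨a, hea, hga⟩ := Nat.find_spec hne
    obtain ⟨d, hd, hdg⟩ : (RightCosets.mk g : RightCosets Γ) ∈ RightCosets.mk '' U a := hga
    obtain ⟨γ, hγ⟩ := RightCosets.exists_mul_eq_of_mk_eq hdg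
    refine mem_iUnion.mpr ⟨γ, d, mem_iUnion.mpr ⟨a, hd, ?_⟩, hγ⟩
    simp only [mem_iUnion, not_exists]
    intro b hb hdb
    refine Nat.find_min hne (hea ▸ hb) ⟨b, rfl, ?_⟩
    have : (RightCosets.mk d : RightCosets Γ) ∈ RightCosets.mk '' U b := hdb
    rwa [hdg] at this
  · intro γ γ' hne
    refine disjoint_left.mpr ?_
    rintro _ ⟨d, hd, rfl⟩ ⟨d', hd', heq⟩
    obtain ⟨a, hda, hda'⟩ := mem_iUnion.mp hd
    obtain ⟨b, hdb, hdb'⟩ := mem_iUnion.mp hd'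
    have heq' : (γ' : G) * d' = γ * d := heq
    have hmk : (RightCosets.mk d : RightCosets Γ) = RightCosets.mk d' := by
      rw [← RightCosets.mk_subgroup_mul γ d, ← heq', RightCosets.mk_subgroup_mul]
    simp only [mem_iUnion, not_exists] at hda' hdb'
    have hab : a = b := by
      rcases lt_trichotomy (e a) (e b) with h | h | h
      · exact absurd ⟨d, hda, hmk⟩ (hdb' a h)
      · exact he h
      · exact absurd ⟨d', hdb, hmk.symm⟩ (hda' b h)
    subst hab
    have hdd : d = d' := hinj a hda hdb hmk
    subst hdd
    exact hne (Subtype.ext (mul_right_cancel heq').symm)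
  · intro x
    obtain ⟨K, hK, hKx⟩ := exists_compact_mem_nhds x
    refine ⟨K, hKx, ?_⟩
    have hF := hfin.finite_nonempty_inter_compact
      (hK.image (RightCosets.continuous_mk (Γ := Γ)))
    refine (hF.biUnion fun a _ => Γ.finite_coe_mem_of_isCompact
      (hK.mul (hUc a).inv)).subset ?_
    rintro γ ⟨_, ⟨d, hd, rfl⟩, hdK⟩
    obtain ⟨a, hda, -⟩ := mem_iUnion.mp hd
    simp only [mem_iUnion]
    refine ⟨a, ⟨RightCosets.mk d, mem_image_of_mem _ hda, _, hdK,
      RightCosets.mk_subgroup_mul γ d⟩, ?_⟩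
    exact ⟨_, hdK, d⁻¹, inv_mem_inv.mpr (subset_closure hda), by simp⟩

end FundamentalDomain

/-! ### Groups with a lattice are unimodular, and `Δ` has finite Haar measure. -/

theorem Subgroup.countable_of_discreteTopology {G : Type u} [Group G] [TopologicalSpace G]
    [SecondCountableTopology G] (Γ : Subgroup G) [DiscreteTopology Γ] : Countable Γ :=
  TopologicalSpace.separableSpace_iff_countable.mp inferInstance

namespace RightCosets

variable {G : Type u} [Group G] [TopologicalSpace G] [IsTopologicalGroup G]
  [SecondCountableTopology G] [MeasurableSpace G] [BorelSpace G]

/-- Countably many open sets on which the quotient map is an open embedding cover `G`. -/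
theorem measurableSet_image_mk {Γ : Subgroup G} [DiscreteTopology Γ]
    [MeasurableSpace (RightCosets Γ)] [BorelSpace (RightCosets Γ)] {A : Set G}
    (hA : MeasurableSet A) : MeasurableSet ((mk : G → RightCosets Γ) '' A) := by
  have h : ∀ a : G, ∃ U ∈ 𝓝 a, IsOpen U ∧ InjOn (mk : G → RightCosets Γ) U := fun a => by
    obtain ⟨U, hU, hinj⟩ := FundamentalDomain.exists_nhds_injOn_mk Γ a
    obtain ⟨W, hWU, hW, haW⟩ := mem_nhds_iff.mp hU
    exact ⟨W, hW.mem_nhds haW, hW, hinj.mono hWU⟩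
  choose U hU hUo hUi using h
  obtain ⟨s, hs, hcov⟩ := TopologicalSpace.countable_cover_nhds hU
  have : (mk : G → RightCosets Γ) '' A = ⋃ a ∈ s, (U a).domRestrict mk '' ((↑) ⁻¹' A) := by
    ext x
    simp only [mem_image, mem_iUnion, mem_preimage, Subtype.exists, exists_prop]
    constructor
    · rintro ⟨g, hg, rfl⟩
      have : g ∈ ⋃ a ∈ s, U a := hcov ▸ mem_univ g
      obtain ⟨a, ha, hga⟩ := mem_iUnion₂.mp this
      exact ⟨a, ha, g, hga, hg, rfl⟩
    · rintro ⟨a, -, g, -, hg, rfl⟩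
      exact ⟨g, hg, rfl⟩
  rw [this]
  refine MeasurableSet.biUnion hs fun a _ => ?_
  have he : IsOpenEmbedding ((U a).domRestrict (mk : G → RightCosets Γ)) :=
    .of_continuous_injective_isOpenMap (continuous_mk.comp continuous_subtype_val)
      (injOn_iff_injective.mp (hUi a)) (isOpenQuotientMap_mk.isOpenMap.domRestrict (hUo a))
  exact he.measurableEmbedding.measurableSet_image' (measurable_subtype_coe hA)

end RightCosets

namespace FundamentalDomain

variable {G : Type u} [Group G] [TopologicalSpace G] [MeasurableSpace G] [BorelSpace G]
  {Γ : Subgroup G} (Δ : FundamentalDomain Γ)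

theorem measurableSet_carrier : MeasurableSet Δ.carrier := by
  have h := Δ.borel_measurable
  rwa [← BorelSpace.measurable_eq (α := G)] at h

variable [IsTopologicalGroup G] [SecondCountableTopology G]

theorem measurable_sec [DiscreteTopology Γ]
    [MeasurableSpace (RightCosets Γ)] [BorelSpace (RightCosets Γ)] : Measurable Δ.sec := by
  intro A hA
  have : Δ.sec ⁻¹' A = RightCosets.mk '' (A ∩ Δ.carrier) := by
    ext x
    constructor
    · exact fun hx => ⟨Δ.sec x, ⟨hx, Δ.sec_mem x⟩, Δ.mk_sec x⟩
    · rintro ⟨d, ⟨hdA, hd⟩, rfl⟩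
      rwa [mem_preimage, Δ.sec_mk hd]
  rw [this]
  exact RightCosets.measurableSet_image_mk (hA.inter Δ.measurableSet_carrier)

/-- The lift to `G` of a measure on `Γ \ G`, obtained by summing over the cosets. -/
noncomputable def lift [MeasurableSpace (RightCosets Γ)] (μ : Measure (RightCosets Γ)) :
    Measure G :=
  Measure.sum fun γ : Γ => μ.map fun x => (γ : G) * Δ.sec x

section Lift

variable [DiscreteTopology Γ] [MeasurableSpace (RightCosets Γ)] [BorelSpace (RightCosets Γ)]
  (μ : Measure (RightCosets Γ))

theorem lift_apply {A : Set G} (hA : MeasurableSet A) :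
    Δ.lift μ A = ∫⁻ x, ∑' γ : Γ, A.indicator 1 ((γ : G) * Δ.sec x) ∂μ := by
  have := Γ.countable_of_discreteTopology
  have hm : ∀ γ : Γ, Measurable fun x => (γ : G) * Δ.sec x := fun γ =>
    Δ.measurable_sec.const_mul _
  have hi : ∀ γ : Γ, AEMeasurable
      (fun x => A.indicator (1 : G → ENNReal) ((γ : G) * Δ.sec x)) μ := fun γ =>
    ((measurable_one.indicator hA).comp (hm γ)).aemeasurable
  rw [lintegral_tsum hi, lift, Measure.sum_apply _ hA]
  refine tsum_congr fun γ => ?_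
  rw [Measure.map_apply (hm γ) hA, ← lintegral_indicator_one (hm γ hA)]
  rfl

theorem lift_preimage_subgroup_mul (γ : Γ) {A : Set G} (hA : MeasurableSet A) :
    Δ.lift μ ((fun g => (γ : G) * g) ⁻¹' A) = Δ.lift μ A := by
  rw [Δ.lift_apply μ hA, Δ.lift_apply μ (measurable_const_mul _ hA)]
  refine lintegral_congr fun x => ?_
  rw [← (Equiv.mulLeft γ).tsum_eq (fun γ' : Γ => A.indicator 1 ((γ' : G) * Δ.sec x))]
  refine tsum_congr fun γ' => ?_
  change A.indicator (1 : G → ENNReal) ((γ : G) * (γ' * Δ.sec x)) = _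
  simp [mul_assoc]

/-- Since `σ(x) g = c(x, g) σ(xg)`, right translation by `g` permutes the sum over `Γ` and replaces
`x` by `xg`, which `μ` does not notice. -/
theorem lift_preimage_mul_right (hμ : ∀ g : G, μ.map (fun x => x.mul g) = μ) (g : G) {A : Set G}
    (hA : MeasurableSet A) : Δ.lift μ ((fun h => h * g) ⁻¹' A) = Δ.lift μ A := by
  have := Γ.countable_of_discreteTopology
  have hF : Measurable fun x => ∑' γ : Γ, A.indicator (1 : G → ENNReal) ((γ : G) * Δ.sec x) :=
    Measurable.tsum fun γ => (measurable_one.indicator hA).comp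
      (Δ.measurable_sec.const_mul _)
  rw [Δ.lift_apply μ hA, Δ.lift_apply μ (measurable_mul_const _ hA)]
  nth_rewrite 2 [← hμ g]
  rw [lintegral_map hF (RightCosets.continuous_mul_right g).measurable]
  refine lintegral_congr fun x => ?_
  rw [← (Equiv.mulRight (Δ.cocycle x g)).tsum_eq
    (fun γ : Γ => A.indicator 1 ((γ : G) * Δ.sec (x.mul g)))]
  refine tsum_congr fun γ => ?_
  change A.indicator (1 : G → ENNReal) ((γ : G) * Δ.sec x * g) = _
  simp [mul_assoc, Δ.sec_mul x g]

theorem lift_carrier : Δ.lift μ Δ.carrier = μ univ := by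
  rw [Δ.lift_apply μ Δ.measurableSet_carrier, ← setLIntegral_one, setLIntegral_univ]
  refine lintegral_congr fun x => ?_
  rw [tsum_eq_single 1]
  · simp [Δ.sec_mem x]
  · intro γ hγ
    refine indicator_of_notMem (fun h => hγ (Δ.eq_one_of_mul_mem (Δ.sec_mem x) h rfl)) _

/-- If `γ₀σ(x)` and `γσ(x)` lie in `K`, then `γγ₀⁻¹ ∈ K K⁻¹`; so a coset meets `K` in at most `|Γ ∩
K K⁻¹|` points, uniformly in the coset. -/
theorem lift_lt_top_of_isCompact [T2Space G] [IsFiniteMeasure μ] {K : Set G} (hK : IsCompact K) :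
    Δ.lift μ K < ⊤ := by
  have hfin : {γ : Γ | (γ : G) ∈ K * K⁻¹}.Finite := Γ.finite_coe_mem_of_isCompact (hK.mul hK.inv)
  rw [Δ.lift_apply μ hK.isClosed.measurableSet]
  refine (lintegral_mono (g := fun _ => (hfin.toFinset.card : ENNReal)) fun x => ?_).trans_lt ?_
  · by_cases hne : ∃ γ : Γ, (γ : G) * Δ.sec x ∈ K
    · obtain ⟨γ₀, hγ₀⟩ := hne
      change ∑' γ : Γ, K.indicator (1 : G → ENNReal) ((γ : G) * Δ.sec x) ≤ _
      rw [← (Equiv.mulRight γ₀).tsum_eq, tsum_eq_sum (s := hfin.toFinset)]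
      · refine (Finset.sum_le_card_nsmul _ _ 1 fun γ _ => ?_).trans (by simp)
        exact indicator_le_self' (by simp) _
      · intro γ hγ
        refine indicator_of_notMem (fun h => hγ ?_) _
        rw [Finite.mem_toFinset]
        exact ⟨_, h, _, inv_mem_inv.mpr hγ₀, by simp [mul_assoc]⟩
    · push Not at hne
      simp [hne]
  · rw [lintegral_const]
    exact ENNReal.mul_lt_top (by simp) (measure_lt_top μ _)

end Lift

-- The modular function at `g` is `η {x | x g ∈ K} / η K`, a parametric integral, measurable in `g`
-- by Tonelli.
open Measure in
theorem measurable_modularCharacterFun [T2Space G] [LocallyCompactSpace G] :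
    Measurable (modularCharacterFun : G → NNReal) := by
  obtain ⟨K⟩ : Nonempty (TopologicalSpace.PositiveCompacts G) := inferInstance
  set η : Measure G := haar
  have h0 : η K ≠ 0 := (measure_pos_of_nonempty_interior _ K.interior_nonempty).ne'
  have h1 : η K ≠ ⊤ := K.isCompact.measure_lt_top.ne
  have hK : MeasurableSet (K : Set G) := K.isCompact.isClosed.measurableSet
  have h : ∀ g : G, (modularCharacterFun g : ENNReal) =
      (∫⁻ x, (K : Set G).indicator 1 (x * g) ∂η) / η K := fun g => by
    rw [ENNReal.eq_div_iff h0 h1, mul_comm]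
    have := congrArg (fun ν : Measure G => ν K) (map_right_mul_eq_modularCharacterFun_smul η g)
    rw [Measure.map_apply (measurable_mul_const g) hK] at this
    rw [← lintegral_indicator_one (measurable_mul_const g hK)] at this
    exact this.symm
  have hm : Measurable fun g : G => (modularCharacterFun g : ENNReal) := by
    simp_rw [h]
    refine Measurable.div_const ?_ _
    exact Measurable.lintegral_prod_left'
      (f := fun q : G × G => (K : Set G).indicator (1 : G → ENNReal) (q.1 * q.2))
      ((measurable_one.indicator hK).comp measurable_mul)
  exact measurable_coe_nnreal_ennreal_iff.mp hm

/-- A finite nonzero measure carries no measurable function which is equidistributed with a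
nontrivial translate of itself. -/
theorem eq_zero_of_map_add_const_eq {X : Type*} [MeasurableSpace X] {μ : Measure X}
    [IsFiniteMeasure μ] (hμ : μ ≠ 0) {f : X → ℝ} (hf : Measurable f) {T : X → X}
    (hT : MeasurePreserving T μ μ) {t : ℝ} (h : ∀ x, f (T x) = f x + t) : t = 0 := by
  -- `arctan` is bounded and strictly increasing: it makes `f` integrable and keeps the comparison
  -- of `f` with `f + t` strict.
  have hb : ∀ g : X → ℝ, Measurable g → Integrable (fun x => Real.arctan (g x)) μ := fun g hg =>
    Integrable.of_bound (Real.continuous_arctan.measurable.comp hg).aestronglyMeasurable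
      (Real.pi / 2) (Eventually.of_forall fun x =>
        (abs_lt.mpr ⟨Real.neg_pi_div_two_lt_arctan _, Real.arctan_lt_pi_div_two _⟩).le)
  have h1 : ∫ x, Real.arctan (f x) ∂μ = ∫ x, Real.arctan (f x + t) ∂μ := by
    have := integral_map (μ := μ) hT.measurable.aemeasurable (f := fun x => Real.arctan (f x))
      (Real.continuous_arctan.measurable.comp hf).aestronglyMeasurable
    rw [hT.map_eq] at this
    rw [this]
    simp_rw [h]
  have key : ∀ p q : X → ℝ, Measurable p → Measurable q → (∀ x, p x < q x) →
      ∫ x, Real.arctan (p x) ∂μ ≠ ∫ x, Real.arctan (q x) ∂μ := fun p q hp hq hpq heq => by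
    have hlt : ∀ x, Real.arctan (p x) < Real.arctan (q x) := fun x =>
      Real.arctan_lt_arctan_iff.mpr (hpq x)
    have h0 : ∫ x, (Real.arctan (q x) - Real.arctan (p x)) ∂μ = 0 := by
      rw [integral_sub (hb _ hq) (hb _ hp), heq, sub_self]
    rw [integral_eq_zero_iff_of_nonneg (fun x => sub_nonneg.mpr (hlt x).le)
      ((hb _ hq).sub (hb _ hp))] at h0
    have hF : ∀ᵐ x ∂μ, False := h0.mono fun x hx => (sub_pos.mpr (hlt x)).ne' hx
    exact hμ (by simpa using hF)
  rcases lt_trichotomy t 0 with ht | ht | ht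
  · exact absurd h1.symm (key _ _ (hf.add_const t) hf fun x => by linarith)
  · exact ht
  · exact absurd h1 (key _ _ hf (hf.add_const t) fun x => by linarith)

open Measure in
/-- A group with a lattice is unimodular, and the fundamental domain has finite Haar measure. -/
theorem measure_carrier_lt_top [T2Space G] [LocallyCompactSpace G] (hΓ : IsLatticeSubgroup Γ)
    (η : Measure G) [η.IsHaarMeasure] : η Δ.carrier < ⊤ := by
  have := hΓ.discrete
  have := RightCosets.t2Space (Γ := Γ)
  obtain ⟨K⟩ : Nonempty (TopologicalSpace.PositiveCompacts G) := inferInstance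
  let _ : MeasurableSpace (RightCosets Γ) := borel _
  have : BorelSpace (RightCosets Γ) := ⟨rfl⟩
  obtain ⟨μ, hμ0, hμ1, hμ⟩ := hΓ.finite_invariant_measure
  have : IsFiniteMeasure μ := ⟨hμ1⟩
  set m := Δ.lift μ with hm
  have hm0 : m ≠ 0 := fun h => hμ0 (by
    rw [← measure_univ_eq_zero, ← Δ.lift_carrier μ, ← hm, h]; rfl)
  have : IsMulRightInvariant m := ⟨fun g => by
    ext A hA
    rw [Measure.map_apply (measurable_mul_const g) hA, Δ.lift_preimage_mul_right μ hμ g hA]⟩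
  have : IsFiniteMeasureOnCompacts m := ⟨fun K hK => Δ.lift_lt_top_of_isCompact μ hK⟩
  have h0 : (haar : Measure G) K ≠ 0 :=
    (measure_pos_of_nonempty_interior _ K.interior_nonempty).ne'
  have h1 : (haar : Measure G) K ≠ ⊤ := K.isCompact.measure_lt_top.ne
  -- `m` is only right invariant so far; its inverse is left invariant, so uniqueness of Haar
  -- measure applies.
  obtain ⟨c, hc⟩ : ∃ c : NNReal, m.inv = c • (haar : Measure G) :=
    ⟨_, isMulLeftInvariant_eq_smul m.inv haar⟩
  have hc0 : c ≠ 0 := fun h => hm0 (by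
    rw [← Measure.inv_inv m, hc, h]; simp [Measure.inv])
  have hmap : ∀ g : G, m.inv.map (· * g) = (modularCharacterFun g) • m.inv := fun g => by
    rw [hc, Measure.map_smul, map_right_mul_eq_modularCharacterFun_smul, smul_comm]
  have hK : m.inv K ≠ 0 ∧ m.inv K ≠ ⊤ := by
    rw [hc]
    simp [h0, h1, hc0, ENNReal.mul_eq_top]
  -- `m` is left `Γ`-invariant, so right translation by `γ` preserves `m.inv` as well as scaling it
  -- by the modular function.
  have hχΓ : ∀ γ : Γ, modularCharacterFun (γ : G) = 1 := fun γ => by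
    have h2 : m.inv.map (· * (γ : G)) K = m.inv K := by
      have hKm : MeasurableSet (K : Set G) := K.isCompact.isClosed.measurableSet
      rw [Measure.map_apply (measurable_mul_const _) hKm, Measure.inv_apply, Measure.inv_apply,
        ← Δ.lift_preimage_subgroup_mul μ γ⁻¹ hKm.inv]
      congr 1
      ext g
      simp
    rw [hmap] at h2
    have h3 : (modularCharacterFun (γ : G) : ENNReal) * m.inv K = 1 * m.inv K := by
      rw [_root_.one_mul]
      exact h2
    exact_mod_cast (ENNReal.mul_left_inj hK.1 hK.2).mp h3
  have hχ : ∀ g : G, modularCharacterFun g = 1 := fun g => by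
    have hmul : ∀ x : RightCosets Γ, modularCharacterFun (Δ.sec (x.mul g)) =
        modularCharacterFun (Δ.sec x) * modularCharacterFun g := fun x => by
      rw [← modularCharacterFun_map_mul, Δ.sec_mul, modularCharacterFun_map_mul, hχΓ,
        _root_.one_mul]
    -- Triviality on `Γ` makes the log-modular function of `σ(x)` shift by a constant when `x`
    -- becomes `xg`.
    have h4 := eq_zero_of_map_add_const_eq (T := fun x : RightCosets Γ => x.mul g)
      (f := fun x => Real.log (modularCharacterFun (Δ.sec x)))
      (t := Real.log (modularCharacterFun g)) hμ0
      (Real.measurable_log.comp (measurable_modularCharacterFun.comp Δ.measurable_sec).coe_nnreal_real)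
      ⟨(RightCosets.continuous_mul_right g).measurable, hμ g⟩ fun x => by
        rw [hmul, NNReal.coe_mul, Real.log_mul]
        · exact_mod_cast (modularCharacterFun_pos _).ne'
        · exact_mod_cast (modularCharacterFun_pos _).ne'
    have h5 : (0 : ℝ) < modularCharacterFun g := modularCharacterFun_pos g
    exact_mod_cast Real.eq_one_of_pos_of_log_eq_zero h5 h4
  have : IsMulRightInvariant m.inv := ⟨fun g => by rw [hmap, hχ, one_smul]⟩
  have : IsMulLeftInvariant m := by
    rw [← Measure.inv_inv m]
    infer_instance
  obtain ⟨k, hk⟩ : ∃ k : NNReal, m = k • η := ⟨_, isMulLeftInvariant_eq_smul m η⟩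
  have hk0 : k ≠ 0 := fun h => hm0 (by rw [hk, h, zero_smul])
  have h6 : (k : ENNReal) * η Δ.carrier = μ univ := by
    rw [← Δ.lift_carrier μ, ← hm, hk]
    rfl
  refine lt_top_iff_ne_top.mpr fun h => hμ1.ne ?_
  rw [← h6, h, ENNReal.mul_top (by exact_mod_cast hk0)]

end FundamentalDomain

/-! ### Good sets and the topology of the induced space. -/

namespace FundamentalDomain

variable {G : Type u} [Group G] [TopologicalSpace G] {Γ : Subgroup G} (Δ : FundamentalDomain Γ)
  (V : PartialSpace.{u, v} Γ)

variable {V}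

theorem mem_preAct {p q : V.carrier × RightCosets Γ} {g : G} :
    q ∈ Δ.preAct V (p, g) ↔ q.1 ∈ V.act (p.1, Δ.cocycle p.2 g) ∧ q.2 = p.2.mul g := by
  obtain ⟨w, y⟩ := q
  simp only [preAct, Part.mem_map_iff, Prod.mk.injEq]
  constructor
  · rintro ⟨a, ha, rfl, rfl⟩
    exact ⟨ha, rfl⟩
  · rintro ⟨ha, rfl⟩
    exact ⟨w, ha, rfl, rfl⟩

theorem preAct_one (hV : V.IsLocalSpace) (p : V.carrier × RightCosets Γ) :
    p ∈ Δ.preAct V (p, 1) := by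
  rw [mem_preAct, cocycle_one, RightCosets.mul_one]
  exact ⟨hV.one_act _, rfl⟩

theorem preAct_inv (hV : V.IsLocalSpace) {p q : V.carrier × RightCosets Γ} {g : G}
    (h : q ∈ Δ.preAct V (p, g)) : p ∈ Δ.preAct V (q, g⁻¹) := by
  rw [mem_preAct] at h ⊢
  obtain ⟨h1, h2⟩ := h
  rw [h2, cocycle_inv, RightCosets.mul_mul, mul_inv_cancel, RightCosets.mul_one]
  exact ⟨hV.act_inv _ _ _ h1, rfl⟩

theorem preAct_mul (hV : V.IsLocalSpace) {p q r s : V.carrier × RightCosets Γ} {g h : G}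
    (h1 : q ∈ Δ.preAct V (p, g)) (h2 : r ∈ Δ.preAct V (q, h)) (h3 : s ∈ Δ.preAct V (p, g * h)) :
    s = r := by
  rw [mem_preAct] at h1 h2 h3
  rw [cocycle_mul] at h3
  rw [h1.2] at h2
  refine Prod.ext (hV.act_mul _ _ _ _ _ _ h1.1 h2.1 h3.1) ?_
  rw [h2.2, h3.2, RightCosets.mul_mul]

namespace IsGood

variable {Δ} {p q r : V.carrier × RightCosets Γ} {O : Set G} {g h : G}

theorem mono (hO : Δ.IsGood V p O) {O' : Set G} (h : O' ⊆ O) (h' : IsOpen O')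
    (h1 : (1 : G) ∈ O') : Δ.IsGood V p O' where
  isOpen := h'
  one_mem := h1
  defined := fun a ha b hb => hO.defined a (h ha) b (h hb)
  injective := fun a ha b hb => hO.injective a (h ha) b (h hb)

theorem exists_mem (hO : Δ.IsGood V p O) (hg : g ∈ O) : ∃ q, q ∈ Δ.preAct V (p, g) := by
  obtain ⟨q, hq, -⟩ := hO.defined g hg g hg
  exact ⟨q, hq⟩

/-- If `O` is good for `p` and `g, h ∈ O`, then `p.g.(g⁻¹ h) = p.h`. -/
theorem mem_preAct_inv_mul (hV : V.IsLocalSpace) (hO : Δ.IsGood V p O) (hg : g ∈ O) (hh : h ∈ O)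
    (hq : q ∈ Δ.preAct V (p, g)) (hr : r ∈ Δ.preAct V (p, h)) : r ∈ Δ.preAct V (q, g⁻¹ * h) := by
  obtain ⟨q', hq', hdom⟩ := hO.defined g hg h hh
  obtain rfl := Part.mem_unique hq hq'
  obtain ⟨s, hs⟩ := Part.dom_iff_mem.mp hdom
  have := Δ.preAct_mul hV hq hs (s := r) (by rwa [mul_inv_cancel_left])
  rwa [this]

/-- Goodness makes `p.g.h` defined through `h = g⁻¹(gh)`; the multiplication axiom, which
presupposes that all terms are defined, then identifies it with `p.(gh)`. -/
theorem mem_preAct_mul (hV : V.IsLocalSpace) (hO : Δ.IsGood V p O) (hg : g ∈ O)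
    (hgh : g * h ∈ O) (hq : q ∈ Δ.preAct V (p, g)) :
    r ∈ Δ.preAct V (q, h) ↔ r ∈ Δ.preAct V (p, g * h) := by
  obtain ⟨s, hs⟩ := hO.exists_mem hgh
  have h1 : s ∈ Δ.preAct V (q, h) := by
    simpa using hO.mem_preAct_inv_mul hV hg hgh hq hs
  constructor
  · intro hr
    rwa [Part.mem_unique hr h1]
  · intro hr
    rwa [Part.mem_unique hr hs]

/-- Recentering: `(ga)⁻¹(gb) = a⁻¹b`, so goodness passes from `O` at `p` to `g⁻¹O` at `p.g`. In
particular every point of `p.O` belongs to the induced space. -/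
theorem translate [IsTopologicalGroup G] (hV : V.IsLocalSpace) (hO : Δ.IsGood V p O) (hg : g ∈ O)
    (hq : q ∈ Δ.preAct V (p, g)) : Δ.IsGood V q ((fun k => g * k) ⁻¹' O) where
  isOpen := hO.isOpen.preimage (continuous_const_mul g)
  one_mem := by simpa using hg
  defined := fun a ha b hb => by
    obtain ⟨r, hr⟩ := hO.exists_mem ha
    obtain ⟨s, hs⟩ := hO.exists_mem hb
    refine ⟨r, (hO.mem_preAct_mul hV hg ha hq).mpr hr, Part.dom_iff_mem.mpr ⟨s, ?_⟩⟩
    have := hO.mem_preAct_inv_mul hV ha hb hr hs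
    simpa [mul_assoc] using this
  injective := fun a ha b hb r hra hrb => by
    rw [hO.mem_preAct_mul hV hg ha hq] at hra
    rw [hO.mem_preAct_mul hV hg hb hq] at hrb
    exact mul_left_cancel (hO.injective _ ha _ hb r hra hrb)

end IsGood

/-- The underlying point of `V × Γ \ G` of a point of the induced space. -/
def toProd (m : (Δ.ind V).carrier) : V.carrier × RightCosets Γ := Subtype.val m

theorem toProd_injective : Function.Injective (Δ.toProd (V := V)) := Subtype.val_injective

theorem exists_isGood (m : (Δ.ind V).carrier) : ∃ O, Δ.IsGood V (Δ.toProd m) O := Subtype.property m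

variable (V)

/-- The set `p.O`, as a subset of the induced space. -/
def orbit (p : V.carrier × RightCosets Γ) (O : Set G) : Set (Δ.ind V).carrier :=
  {m | ∃ g ∈ O, Δ.toProd m ∈ Δ.preAct V (p, g)}

variable {V}

theorem isOpen_orbit {p : V.carrier × RightCosets Γ} {O : Set G} (hO : Δ.IsGood V p O) :
    IsOpen (Δ.orbit V p O) :=
  TopologicalSpace.isOpen_generateFrom_of_mem ⟨p, O, hO, rfl⟩

theorem self_mem_orbit (hV : V.IsLocalSpace) {m : (Δ.ind V).carrier} {O : Set G} (h1 : (1 : G) ∈ O) :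
    m ∈ Δ.orbit V (Δ.toProd m) O := ⟨1, h1, Δ.preAct_one hV _⟩

theorem orbit_mono {p : V.carrier × RightCosets Γ} {O O' : Set G} (h : O ⊆ O') :
    Δ.orbit V p O ⊆ Δ.orbit V p O' := fun _ ⟨g, hg, hm⟩ => ⟨g, h hg, hm⟩

variable [IsTopologicalGroup G]

theorem exists_isGood_of_mem_orbit (hV : V.IsLocalSpace) {p : V.carrier × RightCosets Γ}
    {O : Set G} (hO : Δ.IsGood V p O) {m : (Δ.ind V).carrier} (hm : m ∈ Δ.orbit V p O) :
    ∃ O', Δ.IsGood V (Δ.toProd m) O' ∧ Δ.orbit V (Δ.toProd m) O' ⊆ Δ.orbit V p O := by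
  obtain ⟨g, hg, hm⟩ := hm
  refine ⟨_, hO.translate hV hg hm, ?_⟩
  rintro n ⟨k, hk, hn⟩
  exact ⟨g * k, hk, (hO.mem_preAct_mul hV hg hk hm).mp hn⟩

theorem isTopologicalBasis_orbit (hV : V.IsLocalSpace) :
    TopologicalSpace.IsTopologicalBasis
      {S | ∃ (p : V.carrier × RightCosets Γ) (O : Set G), Δ.IsGood V p O ∧ S = Δ.orbit V p O} where
  exists_subset_inter := by
    rintro _ ⟨p, O, hO, rfl⟩ _ ⟨q, P, hP, rfl⟩ m ⟨hmO, hmP⟩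
    obtain ⟨O', hO', hsO⟩ := Δ.exists_isGood_of_mem_orbit hV hO hmO
    obtain ⟨P', hP', hsP⟩ := Δ.exists_isGood_of_mem_orbit hV hP hmP
    refine ⟨_, ⟨_, O' ∩ P', hO'.mono inter_subset_left (hO'.isOpen.inter hP'.isOpen)
      ⟨hO'.one_mem, hP'.one_mem⟩, rfl⟩, Δ.self_mem_orbit hV ⟨hO'.one_mem, hP'.one_mem⟩, ?_⟩
    exact subset_inter ((Δ.orbit_mono inter_subset_left).trans hsO)
      ((Δ.orbit_mono inter_subset_right).trans hsP)
  sUnion_eq := eq_univ_of_forall fun m => by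
    obtain ⟨O, hO⟩ := Δ.exists_isGood m
    exact ⟨_, ⟨_, O, hO, rfl⟩, Δ.self_mem_orbit hV hO.one_mem⟩
  eq_generateFrom := rfl

omit [IsTopologicalGroup G] in
/-- The sets `m.S`, for `S` a neighbourhood of `1`, are neighbourhoods of `m`. -/
theorem orbit_mem_nhds (hV : V.IsLocalSpace) (m : (Δ.ind V).carrier) {S : Set G} (hS : S ∈ 𝓝 1) :
    Δ.orbit V (Δ.toProd m) S ∈ 𝓝 m := by
  obtain ⟨O, hO⟩ := Δ.exists_isGood m
  have h1 : (1 : G) ∈ O ∩ interior S := ⟨hO.one_mem, mem_interior_iff_mem_nhds.mpr hS⟩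
  have := hO.mono inter_subset_left (hO.isOpen.inter isOpen_interior) h1
  exact mem_of_superset ((Δ.isOpen_orbit this).mem_nhds (Δ.self_mem_orbit hV h1))
    (Δ.orbit_mono (inter_subset_right.trans interior_subset))

/-- Allowing all neighbourhoods `S` of `1`, not only good ones, turns topological questions about
the induced space into filter statements at `1` in `G`. -/
theorem nhds_hasBasis (hV : V.IsLocalSpace) (m : (Δ.ind V).carrier) :
    (𝓝 m).HasBasis (fun S : Set G => S ∈ 𝓝 (1 : G))
      (fun S => Δ.orbit V (Δ.toProd m) S) := by
  refine ⟨fun N => ⟨fun hN => ?_, fun ⟨S, hS, h⟩ => mem_of_superset (Δ.orbit_mem_nhds hV m hS) h⟩⟩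
  obtain ⟨_, ⟨p, O, hO, rfl⟩, hm, hN⟩ := (Δ.isTopologicalBasis_orbit hV).mem_nhds_iff.mp hN
  obtain ⟨O', hO', h⟩ := Δ.exists_isGood_of_mem_orbit hV hO hm
  exact ⟨O', hO'.isOpen.mem_nhds hO'.one_mem, h.trans hN⟩

theorem exists_mem_ind_preAct (hV : V.IsLocalSpace) {p : V.carrier × RightCosets Γ}
    {O : Set G} (hO : Δ.IsGood V p O) {g : G} (hg : g ∈ O) :
    ∃ n : (Δ.ind V).carrier, Δ.toProd n ∈ Δ.preAct V (p, g) := by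
  obtain ⟨q, hq⟩ := hO.exists_mem hg
  exact ⟨⟨q, _, hO.translate hV hg hq⟩, hq⟩

/-- The domain of the action on the induced space. -/
def indDom (V : PartialSpace.{u, v} Γ) : Set ((Δ.ind V).carrier × G) :=
  interior {y | ∃ n : (Δ.ind V).carrier, Δ.toProd n ∈ Δ.preAct V (Δ.toProd y.1, y.2)}

omit [IsTopologicalGroup G] in
theorem mem_ind_act {m n : (Δ.ind V).carrier} {g : G} :
    n ∈ (Δ.ind V).act (m, g) ↔ (m, g) ∈ Δ.indDom V ∧ Δ.toProd n ∈ Δ.preAct V (Δ.toProd m, g) := by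
  constructor
  · rintro ⟨h, rfl⟩
    exact ⟨h, Classical.choose_spec (interior_subset h :
      (m, g) ∈ (Δ.indPreAct V).Dom)⟩
  · rintro ⟨h, hn⟩
    have hd : ((Δ.ind V).act (m, g)).Dom := h
    refine ⟨hd, Subtype.ext ?_⟩
    exact Part.mem_unique (Classical.choose_spec (interior_subset h :
      (m, g) ∈ (Δ.indPreAct V).Dom)) hn

end FundamentalDomain

/-! ### Local spaces of a discrete group. -/

namespace PartialSpace.IsLocalSpace

variable {G : Type u} [Group G] [TopologicalSpace G] [DiscreteTopology G]
  {V : PartialSpace.{u, v} G}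

theorem isOpen_singleton (hV : V.IsLocalSpace) (p : V.carrier) : IsOpen ({p} : Set V.carrier) := by
  obtain ⟨O, -, h1, h, he, -⟩ := hV.homogeneous p
  have h2 := he.isOpenMap {⟨1, h1⟩} (isOpen_discrete _)
  rw [image_singleton] at h2
  convert h2
  exact Part.mem_unique (hV.one_act p) (Part.get_mem _)

theorem discreteTopology (hV : V.IsLocalSpace) : DiscreteTopology V.carrier :=
  discreteTopology_iff_forall_isOpen.mpr fun s => by
    rw [← biUnion_of_singleton s]
    exact isOpen_biUnion fun p _ => hV.isOpen_singleton p

theorem countable (hV : V.IsLocalSpace) : Countable V.carrier := by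
  have := hV.discreteTopology
  have := hV.secondCountable
  exact TopologicalSpace.separableSpace_iff_countable.mp inferInstance

end PartialSpace.IsLocalSpace

/-! ### The induced space is a local `G`-space. -/

namespace FundamentalDomain

variable {G : Type u} [Group G] [TopologicalSpace G] [IsTopologicalGroup G] {Γ : Subgroup G}
  (Δ : FundamentalDomain Γ) {V : PartialSpace.{u, v} Γ}

theorem eventually_nhds_prod_iff (hV : V.IsLocalSpace) {m : (Δ.ind V).carrier} {g : G}
    {P : (Δ.ind V).carrier → G → Prop} :
    (∀ᶠ z in 𝓝 (m, g), P z.1 z.2) ↔ ∀ᶠ q in 𝓝 (1 : G) ×ˢ 𝓝 g,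
      ∀ m', Δ.toProd m' ∈ Δ.preAct V (Δ.toProd m, q.1) → P m' q.2 := by
  rw [nhds_prod_eq, ((Δ.nhds_hasBasis hV m).prod (𝓝 g).basis_sets).eventually_iff,
    ((𝓝 (1 : G)).basis_sets.prod (𝓝 g).basis_sets).eventually_iff]
  refine exists_congr fun ST => and_congr_right fun _ => ?_
  constructor
  · exact fun h q hq m' hm' => h (x := (m', q.2)) ⟨⟨q.1, hq.1, hm'⟩, hq.2⟩
  · rintro h ⟨m', g'⟩ ⟨⟨k, hk, hm'⟩, hg'⟩
    exact h (x := (k, g')) ⟨hk, hg'⟩ m' hm'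

theorem mem_indDom_iff (hV : V.IsLocalSpace) {m : (Δ.ind V).carrier} {g : G} :
    (m, g) ∈ Δ.indDom V ↔ ∀ᶠ q in 𝓝 (1 : G) ×ˢ 𝓝 g,
      ∀ m', Δ.toProd m' ∈ Δ.preAct V (Δ.toProd m, q.1) →
        ∃ n, Δ.toProd n ∈ Δ.preAct V (Δ.toProd m', q.2) := by
  rw [indDom, mem_interior_iff_mem_nhds]
  exact Δ.eventually_nhds_prod_iff hV
    (P := fun m' g' => ∃ n, Δ.toProd n ∈ Δ.preAct V (Δ.toProd m', g'))

/-- For `a` near `1` and `g'` near `g`, the points `m.a.g'`, `m.(a g')` and `n.(g⁻¹ a g')` are all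
defined, so the multiplication axiom makes them equal. This is the action in local coordinates; its
continuity and the openness of domains under inversion both rest on it. -/
theorem eventually_preAct (hV : V.IsLocalSpace) {m n : (Δ.ind V).carrier} {g : G}
    (hd : (m, g) ∈ Δ.indDom V) (hn : Δ.toProd n ∈ Δ.preAct V (Δ.toProd m, g)) :
    ∀ᶠ q in 𝓝 (1 : G) ×ˢ 𝓝 g, ∀ m', Δ.toProd m' ∈ Δ.preAct V (Δ.toProd m, q.1) →
      ∃ n', Δ.toProd n' ∈ Δ.preAct V (Δ.toProd m', q.2) ∧
        Δ.toProd n' ∈ Δ.preAct V (Δ.toProd n, g⁻¹ * q.1 * q.2) := by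
  rw [Δ.mem_indDom_iff hV] at hd
  obtain ⟨O, hO⟩ := Δ.exists_isGood n
  have hT : ∀ᶠ g' in 𝓝 g, ∃ r, Δ.toProd r ∈ Δ.preAct V (Δ.toProd m, g') := by
    obtain ⟨A, hA, B, hB, h⟩ := eventually_prod_iff.mp hd
    exact hB.mono fun g' hg' => h hA.self_of_nhds hg' m (Δ.preAct_one hV _)
  have h1 : Tendsto (fun q : G × G => q.1 * q.2) (𝓝 (1 : G) ×ˢ 𝓝 g) (𝓝 g) := by
    rw [← nhds_prod_eq]
    have : Continuous fun q : G × G => q.1 * q.2 := by fun_prop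
    simpa using this.tendsto (1, g)
  have h2 : Tendsto (fun q : G × G => g⁻¹ * q.1 * q.2) (𝓝 (1 : G) ×ˢ 𝓝 g) (𝓝 1) := by
    rw [← nhds_prod_eq]
    have : Continuous fun q : G × G => g⁻¹ * q.1 * q.2 := by fun_prop
    simpa using this.tendsto (1, g)
  filter_upwards [hd, h1.eventually hT, h2.eventually (hO.isOpen.mem_nhds hO.one_mem)]
    with q hq hq1 hq2 m' hm'
  obtain ⟨n', hn'⟩ := hq m' hm'
  obtain ⟨r, hr⟩ := hq1
  obtain ⟨s, hs⟩ := Δ.exists_mem_ind_preAct hV hO hq2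
  have e1 := Δ.preAct_mul hV hm' hn' hr
  have e2 := Δ.preAct_mul hV hn hs (s := Δ.toProd r) (by simpa [mul_assoc] using hr)
  exact ⟨n', hn', by rwa [← e1, e2]⟩

theorem mem_indDom_of_isGood (hV : V.IsLocalSpace) {m : (Δ.ind V).carrier} {O : Set G}
    (hO : Δ.IsGood V (Δ.toProd m) O) {g : G} (hg : g ∈ O) : (m, g) ∈ Δ.indDom V := by
  rw [Δ.mem_indDom_iff hV]
  have h1 : Tendsto (fun q : G × G => q.1 * q.2) (𝓝 (1 : G) ×ˢ 𝓝 g) (𝓝 g) := by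
    rw [← nhds_prod_eq]
    have : Continuous fun q : G × G => q.1 * q.2 := by fun_prop
    simpa using this.tendsto (1, g)
  filter_upwards [tendsto_fst.eventually (hO.isOpen.mem_nhds hO.one_mem),
    h1.eventually (hO.isOpen.mem_nhds hg)] with q hq1 hq2 m' hm'
  obtain ⟨n, hn⟩ := Δ.exists_mem_ind_preAct hV hO hq2
  exact ⟨n, (hO.mem_preAct_mul hV hq1 hq2 hm').mpr hn⟩

/-- Around `m.g` the map `g' ↦ m.g'` reads `g' ↦ g⁻¹g'` in orbit coordinates, which is a
homeomorphism. -/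
theorem isHomeoOntoNhd_of_isGood (hV : V.IsLocalSpace) {m : (Δ.ind V).carrier} {O : Set G}
    (hO : Δ.IsGood V (Δ.toProd m) O) : (Δ.ind V).IsHomeoOntoNhd m O := by
  have hd : ∀ g ∈ O, ((Δ.ind V).act (m, g)).Dom := fun g hg => Δ.mem_indDom_of_isGood hV hO hg
  set f : O → (Δ.ind V).carrier := fun g => ((Δ.ind V).act (m, (g : G))).get (hd g g.2) with hf
  have hfm : ∀ g : O, Δ.toProd (f g) ∈ Δ.preAct V (Δ.toProd m, g) := fun g =>
    (Δ.mem_ind_act.mp (Part.get_mem (hd g g.2))).2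
  refine ⟨hd, .of_continuous_injective_isOpenMap ?_ ?_ ?_, ⟨1, hO.one_mem⟩, ?_⟩
  · refine continuous_iff_continuousAt.mpr fun g => ?_
    rw [ContinuousAt, (Δ.nhds_hasBasis hV (f g)).tendsto_right_iff]
    intro S hS
    have h1 : Tendsto (fun g' : O => (g : G)⁻¹ * g') (𝓝 g) (𝓝 1) := by
      have : Continuous fun g' : O => (g : G)⁻¹ * g' := by fun_prop
      simpa using this.tendsto g
    filter_upwards [h1.eventually hS] with g' hg'
    exact ⟨_, hg', hO.mem_preAct_inv_mul hV g.2 g'.2 (hfm g) (hfm g')⟩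
  · intro g g' h
    exact Subtype.ext (hO.injective _ g.2 _ g'.2 _ (hfm g) (by
      have := hfm g'
      rwa [← show f g = f g' from h] at this))
  · refine isOpenMap_iff_nhds_le.mpr fun g A hA => ?_
    rw [mem_map, nhds_subtype_eq_comap] at hA
    obtain ⟨B, hB, hBA⟩ := hA
    have h1 : Tendsto (fun k : G => g * k) (𝓝 1) (𝓝 (g : G)) := by
      simpa using (continuous_const_mul (g : G)).tendsto 1
    refine mem_of_superset (Δ.orbit_mem_nhds (S := (fun k => (g : G) * k) ⁻¹' (B ∩ O)) hV (f g)
      (h1 (inter_mem hB (hO.isOpen.mem_nhds g.2)))) ?_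
    rintro n ⟨k, ⟨hkB, hkO⟩, hn⟩
    have h2 := (hO.mem_preAct_mul hV g.2 hkO (hfm g)).mp hn
    have h3 : n = f ⟨g * k, hkO⟩ := Δ.toProd_injective (Part.mem_unique h2 (hfm ⟨g * k, hkO⟩))
    rw [h3]
    exact hBA hkB
  · exact Δ.toProd_injective (Part.mem_unique (hfm ⟨1, hO.one_mem⟩) (Δ.preAct_one hV _))

theorem isChart_of_isGood (hV : V.IsLocalSpace) {m : (Δ.ind V).carrier} {O : Set G}
    (hO : Δ.IsGood V (Δ.toProd m) O) : (Δ.ind V).IsChart m O :=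
  ⟨hO.isOpen, hO.one_mem, Δ.isHomeoOntoNhd_of_isGood hV hO⟩

/-- The point `m.g` has the good set `g⁻¹O`, which contains `h` when `gh ∈ O`; this puts `(m.g, h)`
in the interior domain. -/
theorem mem_goodPoints_of_isGood (hV : V.IsLocalSpace) {m : (Δ.ind V).carrier} {O : Set G}
    (hO : Δ.IsGood V (Δ.toProd m) O) : m ∈ (Δ.ind V).goodPoints O := by
  refine ⟨fun g h hg _ hgh => ?_, Δ.isHomeoOntoNhd_of_isGood hV hO⟩
  obtain ⟨q, hq⟩ := Δ.exists_mem_ind_preAct hV hO hg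
  obtain ⟨r, hr⟩ := Δ.exists_mem_ind_preAct hV hO hgh
  refine ⟨q, r, Δ.mem_ind_act.mpr ⟨Δ.mem_indDom_of_isGood hV hO hg, hq⟩,
    Δ.mem_ind_act.mpr ⟨Δ.mem_indDom_of_isGood hV (hO.translate hV hg hq) hgh, ?_⟩,
    Δ.mem_ind_act.mpr ⟨Δ.mem_indDom_of_isGood hV hO hgh, hr⟩⟩
  exact (hO.mem_preAct_mul hV hg hgh hq).mpr hr

theorem ind_continuous_act (hV : V.IsLocalSpace) : Continuous (Δ.ind V).act.asSubtype := by
  refine continuous_iff_continuousAt.mpr ?_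
  rintro ⟨⟨m, g⟩, hd⟩
  set n := (Δ.ind V).act.asSubtype ⟨(m, g), hd⟩ with hn
  have hn' : n ∈ (Δ.ind V).act (m, g) := Part.get_mem hd
  obtain ⟨hmd, hmn⟩ := Δ.mem_ind_act.mp hn'
  rw [ContinuousAt, ← hn, (Δ.nhds_hasBasis hV n).tendsto_right_iff]
  intro S hS
  have h2 : Tendsto (fun q : G × G => g⁻¹ * q.1 * q.2) (𝓝 (1 : G) ×ˢ 𝓝 g) (𝓝 1) := by
    rw [← nhds_prod_eq]
    have : Continuous fun q : G × G => g⁻¹ * q.1 * q.2 := by fun_prop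
    simpa using this.tendsto (1, g)
  have key : ∀ᶠ z in 𝓝 (m, g), ∀ n' ∈ (Δ.ind V).act (z.1, z.2),
      n' ∈ Δ.orbit V (Δ.toProd n) S := by
    rw [Δ.eventually_nhds_prod_iff hV
      (P := fun m' g' => ∀ n' ∈ (Δ.ind V).act (m', g'), n' ∈ Δ.orbit V (Δ.toProd n) S)]
    filter_upwards [Δ.eventually_preAct hV hmd hmn, h2.eventually hS] with q hq hqS m' hm' n' hn'
    obtain ⟨n'', h3, h4⟩ := hq m' hm'
    have h5 := Part.mem_unique (Δ.mem_ind_act.mp hn').2 h3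
    exact ⟨_, hqS, by rwa [h5]⟩
  have := (continuous_subtype_val (p := fun z => z ∈ (Δ.ind V).act.Dom)).continuousAt
    (x := ⟨(m, g), hd⟩) |>.eventually key
  filter_upwards [this] with y hy
  exact hy _ (Part.get_mem y.2)

/-- The point at issue is that `(n, g⁻¹)` is interior to the domain. For `n' = n.a` and `g'` near
`g⁻¹`, put `m' = m.(g a g')`; then `m'.g'⁻¹ = n.a = n'`, so `n'.g' = m'`. -/
theorem ind_act_inv (hV : V.IsLocalSpace) {m n : (Δ.ind V).carrier} {g : G}
    (h : n ∈ (Δ.ind V).act (m, g)) : m ∈ (Δ.ind V).act (n, g⁻¹) := by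
  obtain ⟨hd, hn⟩ := Δ.mem_ind_act.mp h
  refine Δ.mem_ind_act.mpr ⟨?_, Δ.preAct_inv hV hn⟩
  rw [Δ.mem_indDom_iff hV]
  obtain ⟨O, hO⟩ := Δ.exists_isGood m
  have h1 : Tendsto (fun q : G × G => g * q.1 * q.2) (𝓝 (1 : G) ×ˢ 𝓝 g⁻¹) (𝓝 1) := by
    rw [← nhds_prod_eq]
    have : Continuous fun q : G × G => g * q.1 * q.2 := by fun_prop
    simpa using this.tendsto (1, g⁻¹)
  have h2 : Tendsto (fun q : G × G => q.2⁻¹) (𝓝 (1 : G) ×ˢ 𝓝 g⁻¹) (𝓝 g) := by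
    simpa using (tendsto_snd (f := 𝓝 (1 : G)) (g := 𝓝 g⁻¹)).inv
  filter_upwards [(h1.prodMk h2).eventually (Δ.eventually_preAct hV hd hn),
    h1.eventually (hO.isOpen.mem_nhds hO.one_mem)] with q hq hqO n' hn'
  obtain ⟨m', hm'⟩ := Δ.exists_mem_ind_preAct hV hO hqO
  obtain ⟨n'', h3, h4⟩ := hq m' hm'
  simp only [mul_assoc, inv_mul_cancel_left, mul_inv_cancel, mul_one] at h4
  have h5 := Part.mem_unique h4 hn'
  rw [h5] at h3
  exact ⟨m', by simpa using Δ.preAct_inv hV h3⟩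

theorem ind_locallyCompactSpace [LocallyCompactSpace G] (hV : V.IsLocalSpace) :
    LocallyCompactSpace (Δ.ind V).carrier where
  local_compact_nhds m n hn := by
    obtain ⟨O, hO⟩ := Δ.exists_isGood m
    obtain ⟨hd, he, a, ha⟩ := Δ.isHomeoOntoNhd_of_isGood hV hO
    have := hO.isOpen.locallyCompactSpace
    rw [← ha] at hn ⊢
    obtain ⟨s, hs, hsn, hsc⟩ := local_compact_nhds (he.continuous.continuousAt hn)
    exact ⟨_, he.isOpenMap.image_mem_nhds hs, image_subset_iff.mpr hsn, hsc.image he.continuous⟩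

/-- Over distinct cosets, separate in `Γ \ G`. Over the same coset, a common point `m.g = n.h` with
`g, h` small forces `g = h` by local injectivity of the quotient map, hence `m = n` by inverting. -/
theorem ind_t2Space [T2Space G] [DiscreteTopology Γ] (hV : V.IsLocalSpace) :
    T2Space (Δ.ind V).carrier := by
  have := RightCosets.t2Space (Γ := Γ)
  rw [t2Space_iff_disjoint_nhds]
  intro m n hmn
  rw [(Δ.nhds_hasBasis hV m).disjoint_iff (Δ.nhds_hasBasis hV n)]
  by_cases hx : (Δ.toProd m).2 = (Δ.toProd n).2
  · obtain ⟨N, hN, hinj⟩ := exists_nhds_injOn_mk Γ (Δ.sec (Δ.toProd m).2)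
    have h1 : Tendsto (fun k : G => Δ.sec (Δ.toProd m).2 * k) (𝓝 1)
        (𝓝 (Δ.sec (Δ.toProd m).2)) := by
      simpa using (continuous_const_mul (Δ.sec (Δ.toProd m).2)).tendsto 1
    refine ⟨_, h1 hN, _, h1 hN, disjoint_left.mpr ?_⟩
    rintro r ⟨g, hg, hrg⟩ ⟨h, hh, hrh⟩
    have h2 := (Δ.mem_preAct.mp hrg).2
    have h3 := (Δ.mem_preAct.mp hrh).2
    rw [h2, ← hx, Δ.mul_eq_mk, Δ.mul_eq_mk] at h3
    obtain rfl := mul_left_cancel (hinj hg hh h3)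
    exact hmn (Δ.toProd_injective (Part.mem_unique (Δ.preAct_inv hV hrg) (Δ.preAct_inv hV hrh)))
  · obtain ⟨A, B, hA, hB, hmA, hnB, hAB⟩ := t2_separation hx
    have h1 : ∀ (x : RightCosets Γ) (C : Set (RightCosets Γ)), IsOpen C → x ∈ C →
        (fun g => x.mul g) ⁻¹' C ∈ 𝓝 (1 : G) := fun x C hC hxC => by
      have : Continuous fun g => x.mul g := by
        simp_rw [Δ.mul_eq_mk]
        exact RightCosets.continuous_mk.comp (continuous_const_mul _)
      exact this.continuousAt (hC.mem_nhds (by rwa [RightCosets.mul_one]))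
    refine ⟨_, h1 _ A hA hmA, _, h1 _ B hB hnB, disjoint_left.mpr ?_⟩
    rintro r ⟨g, hg, hrg⟩ ⟨h, hh, hrh⟩
    refine disjoint_left.mp hAB hg ?_
    change (Δ.toProd m).2.mul g ∈ B
    rw [← (Δ.mem_preAct.mp hrg).2, (Δ.mem_preAct.mp hrh).2]
    exact hh

theorem secondCountableTopology_orbit [SecondCountableTopology G] (hV : V.IsLocalSpace)
    {p : V.carrier × RightCosets Γ} {O : Set G} (hO : Δ.IsGood V p O) :
    SecondCountableTopology (Δ.orbit V p O) := by
  obtain ⟨m, rfl⟩ : ∃ m : (Δ.ind V).carrier, Δ.toProd m = p := ⟨⟨p, O, hO⟩, rfl⟩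
  obtain ⟨hd, he, -⟩ := Δ.isHomeoOntoNhd_of_isGood hV hO
  have := he.isEmbedding.toHomeomorph.symm.isEmbedding.secondCountableTopology
  convert this using 2 <;>
  · ext n
    constructor
    · rintro ⟨g, hg, hn⟩
      exact ⟨⟨g, hg⟩, Δ.toProd_injective (Part.mem_unique
        (Δ.mem_ind_act.mp (Part.get_mem (hd g hg))).2 hn)⟩
    · rintro ⟨g, rfl⟩
      exact ⟨g, g.2, (Δ.mem_ind_act.mp (Part.get_mem (hd g g.2))).2⟩

/-- Countably many of the sets `p.O` with `O` good for `p` cover the induced space. -/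
theorem exists_countable_orbit_cover [SecondCountableTopology G] [DiscreteTopology Γ]
    (hV : V.IsLocalSpace) : ∃ C : Set ((V.carrier × RightCosets Γ) × Set G), C.Countable ∧
      (∀ c ∈ C, Δ.IsGood V c.1 c.2) ∧ (⋃ c ∈ C, Δ.orbit V c.1 c.2) = univ := by
  have := hV.countable
  let D : V.carrier → Set G → Set G := fun v O =>
    {d | d ∈ Δ.carrier ∧ Δ.IsGood V (v, RightCosets.mk d) O}
  -- For fixed `v` and basic `O`, hereditary Lindelöfness of `G` selects countably many base points
  -- `d ∈ Δ` whose sets `d O` cover all admissible ones.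
  have hcov : ∀ v O, ∃ t ⊆ D v O, t.Countable ∧ D v O ⊆ ⋃ d ∈ t, (fun e => d⁻¹ * e) ⁻¹' O :=
    fun v O => TopologicalSpace.countable_cover_nhdsWithin fun d hd => mem_nhdsWithin_of_mem_nhds
      ((continuous_const_mul d⁻¹).continuousAt (hd.2.isOpen.mem_nhds (by simpa using hd.2.one_mem)))
  choose t htD ht hcov using hcov
  refine ⟨⋃ v, ⋃ O ∈ TopologicalSpace.countableBasis G,
    (fun d => ((v, RightCosets.mk d), O)) '' t v O, ?_, ?_, ?_⟩
  · exact countable_iUnion fun v => (TopologicalSpace.countable_countableBasis G).biUnion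
      fun O _ => (ht v O).image _
  · intro c hc
    simp only [mem_iUnion] at hc
    obtain ⟨v, O, -, d, hd, rfl⟩ := hc
    exact (htD v O hd).2
  · refine eq_univ_of_forall fun m => ?_
    obtain ⟨O', hO'⟩ := Δ.exists_isGood m
    obtain ⟨O, hOB, h1, hOO⟩ := (TopologicalSpace.isBasis_countableBasis G).mem_nhds_iff.mp
      (hO'.isOpen.mem_nhds hO'.one_mem)
    have hO := hO'.mono hOO ((TopologicalSpace.isBasis_countableBasis G).isOpen hOB) h1
    obtain ⟨d, hd, hdO⟩ := mem_iUnion₂.mp (hcov (Δ.toProd m).1 O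
      (show Δ.sec (Δ.toProd m).2 ∈ _ from ⟨Δ.sec_mem _, by rwa [Δ.mk_sec]⟩))
    refine mem_iUnion₂.mpr ⟨(((Δ.toProd m).1, RightCosets.mk d), O), ?_, _, hdO, ?_⟩
    · simp only [mem_iUnion]
      exact ⟨_, O, hOB, d, hd, rfl⟩
    · rw [Δ.mem_preAct]
      -- A move between two points of `Δ` has trivial cocycle, so the `V`-coordinate does not
      -- change.
      have h2 := Δ.cocycle_eq_of_mul_eq (x := RightCosets.mk d)
        (g := d⁻¹ * Δ.sec (Δ.toProd m).2) (γ := 1) (Δ.sec_mem (Δ.toProd m).2)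
        (by simp [Δ.sec_mk (htD _ _ hd).1])
      refine ⟨?_, Δ.sec_injective h2.2.symm⟩
      change _ ∈ V.act (_, Δ.cocycle (RightCosets.mk d) (d⁻¹ * Δ.sec (Δ.toProd m).2))
      rw [h2.1]
      exact hV.one_act _

theorem ind_secondCountableTopology [SecondCountableTopology G] [DiscreteTopology Γ]
    (hV : V.IsLocalSpace) : SecondCountableTopology (Δ.ind V).carrier := by
  obtain ⟨C, hC, hgood, hcov⟩ := Δ.exists_countable_orbit_cover hV
  have := hC.to_subtype
  have : ∀ c : C, SecondCountableTopology (Δ.orbit V c.1.1 c.1.2) := fun c =>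
    Δ.secondCountableTopology_orbit hV (hgood _ c.2)
  refine TopologicalSpace.secondCountableTopology_of_countable_cover
    (U := fun c : C => Δ.orbit V c.1.1 c.1.2) (fun c => Δ.isOpen_orbit (hgood _ c.2)) ?_
  rw [← hcov, biUnion_eq_iUnion]

theorem isLocalSpace_ind [T2Space G] [LocallyCompactSpace G] [SecondCountableTopology G]
    [DiscreteTopology Γ] (hV : V.IsLocalSpace) : (Δ.ind V).IsLocalSpace where
  hausdorff := Δ.ind_t2Space hV
  locallyCompact := Δ.ind_locallyCompactSpace hV
  secondCountable := Δ.ind_secondCountableTopology hV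
  isOpen_dom := show IsOpen (Δ.indDom V) from isOpen_interior
  continuous_act := Δ.ind_continuous_act hV
  one_act m := by
    obtain ⟨O, hO⟩ := Δ.exists_isGood m
    exact Δ.mem_ind_act.mpr ⟨Δ.mem_indDom_of_isGood hV hO hO.one_mem, Δ.preAct_one hV _⟩
  act_inv _ _ _ h := Δ.ind_act_inv hV h
  act_mul p g h q r s hq hr hs := Δ.toProd_injective (Δ.preAct_mul hV (Δ.mem_ind_act.mp hq).2
    (Δ.mem_ind_act.mp hr).2 (Δ.mem_ind_act.mp hs).2)
  homogeneous m := by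
    obtain ⟨O, hO⟩ := Δ.exists_isGood m
    exact ⟨O, Δ.isChart_of_isGood hV hO⟩

end FundamentalDomain

/-! ### The canonical measure of the induced space. -/

namespace FundamentalDomain

variable {G : Type u} [Group G] [TopologicalSpace G] {Γ : Subgroup G}
  (Δ : FundamentalDomain Γ) {V : PartialSpace.{u, v} Γ}

/-- The set of all `e ∈ Δ` such that `(w, Γ e)` lies in `K`. -/
def slice (w : V.carrier) (K : Set (Δ.ind V).carrier) : Set G :=
  {e | e ∈ Δ.carrier ∧ ∃ m ∈ K, Δ.toProd m = (w, RightCosets.mk e)}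

theorem slice_subset (w : V.carrier) (K : Set (Δ.ind V).carrier) : Δ.slice w K ⊆ Δ.carrier :=
  fun _ h => h.1

theorem slice_empty (w : V.carrier) : Δ.slice (V := V) w ∅ = ∅ := by
  ext; simp [slice]

theorem slice_iUnion {ι : Sort*} (w : V.carrier) (K : ι → Set (Δ.ind V).carrier) :
    Δ.slice w (⋃ i, K i) = ⋃ i, Δ.slice w (K i) := by
  ext e
  simp only [slice, mem_ofPred_eq, mem_iUnion]
  constructor
  · rintro ⟨he, m, ⟨i, hm⟩, h⟩
    exact ⟨i, he, m, hm, h⟩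
  · rintro ⟨i, he, m, hm, h⟩
    exact ⟨he, m, ⟨i, hm⟩, h⟩

theorem disjoint_slice (w : V.carrier) {K L : Set (Δ.ind V).carrier} (h : Disjoint K L) :
    Disjoint (Δ.slice w K) (Δ.slice w L) := by
  refine disjoint_left.mpr ?_
  rintro e ⟨_, m, hm, h1⟩ ⟨_, n, hn, h2⟩
  obtain rfl := Δ.toProd_injective (h1.trans h2.symm)
  exact disjoint_left.mp h hm hn

/-- The slice of the whole space may be smaller than `Δ`, since points without a good set are
missing. -/
theorem slice_compl (w : V.carrier) (K : Set (Δ.ind V).carrier) :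
    Δ.slice w Kᶜ = Δ.slice w univ \ Δ.slice w K := by
  ext e
  constructor
  · rintro ⟨he, m, hm, h⟩
    refine ⟨⟨he, m, trivial, h⟩, ?_⟩
    rintro ⟨_, n, hn, h'⟩
    obtain rfl := Δ.toProd_injective (h.trans h'.symm)
    exact hm hn
  · rintro ⟨⟨he, m, _, h⟩, h'⟩
    exact ⟨he, m, fun hm => h' ⟨he, m, hm, h⟩, h⟩

variable [IsTopologicalGroup G]

/-- The element `g` with `p.g = (w, Γe)` and cocycle `γ` satisfies `σ(p.2) g = γ e`, so it is
determined by `γ` and `e`. -/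
theorem slice_orbit (hV : V.IsLocalSpace) {p : V.carrier × RightCosets Γ} {O : Set G}
    (hO : Δ.IsGood V p O) (w : V.carrier) : Δ.slice w (Δ.orbit V p O) =
      ⋃ (γ : Γ) (_ : w ∈ V.act (p.1, γ)),
        Δ.carrier ∩ (fun e => (Δ.sec p.2)⁻¹ * γ * e) ⁻¹' O := by
  ext e
  simp only [mem_iUnion, mem_inter_iff, mem_preimage, exists_prop]
  constructor
  · rintro ⟨he, m, ⟨g, hg, hm⟩, hme⟩
    rw [mem_preAct, hme] at hm
    refine ⟨_, hm.1, he, ?_⟩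
    have h2 : RightCosets.mk e = p.2.mul g := hm.2
    have : (Δ.sec p.2)⁻¹ * Δ.cocycle p.2 g * e = g := by
      rw [mul_assoc, ← Δ.sec_mk he, h2, ← Δ.sec_mul, inv_mul_cancel_left]
    rwa [this]
  · rintro ⟨γ, hw, he, hg⟩
    obtain ⟨m, hm⟩ := Δ.exists_mem_ind_preAct hV hO hg
    have h1 := Δ.cocycle_eq_of_mul_eq (x := p.2) (g := (Δ.sec p.2)⁻¹ * γ * e) (γ := γ) he
      (by simp [mul_assoc])
    refine ⟨he, m, ⟨_, hg, hm⟩, ?_⟩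
    rw [mem_preAct, h1.1] at hm
    refine Prod.ext (Part.mem_unique hm.1 hw) ?_
    exact hm.2.trans ((Δ.mk_sec _).symm.trans (congrArg RightCosets.mk h1.2))

variable [SecondCountableTopology G] [MeasurableSpace G] [BorelSpace G] [DiscreteTopology Γ]

theorem measurableSet_slice_orbit (hV : V.IsLocalSpace) {p : V.carrier × RightCosets Γ} {O : Set G}
    (hO : Δ.IsGood V p O) (w : V.carrier) : MeasurableSet (Δ.slice w (Δ.orbit V p O)) := by
  have := Γ.countable_of_discreteTopology
  rw [Δ.slice_orbit hV hO]
  refine MeasurableSet.iUnion fun γ => MeasurableSet.iUnion fun _ =>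
    Δ.measurableSet_carrier.inter (hO.isOpen.preimage (continuous_const_mul _)).measurableSet

variable [MeasurableSpace (Δ.ind V).carrier] [BorelSpace (Δ.ind V).carrier]

theorem measurableSet_slice (hV : V.IsLocalSpace) (w : V.carrier) {K : Set (Δ.ind V).carrier}
    (hK : MeasurableSet K) : MeasurableSet (Δ.slice w K) := by
  have := Δ.ind_secondCountableTopology hV
  have huniv : MeasurableSet (Δ.slice (V := V) w univ) := by
    obtain ⟨C, hC, hgood, hcov⟩ := Δ.exists_countable_orbit_cover hV
    have := hC.to_subtype
    rw [← hcov, biUnion_eq_iUnion, slice_iUnion]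
    exact MeasurableSet.iUnion fun c => Δ.measurableSet_slice_orbit hV (hgood _ c.2) w
  rw [BorelSpace.measurable_eq (α := (Δ.ind V).carrier),
    (Δ.isTopologicalBasis_orbit hV).borel_eq_generateFrom] at hK
  induction hK with
  | basic S hS =>
    obtain ⟨p, O, hO, rfl⟩ := hS
    exact Δ.measurableSet_slice_orbit hV hO w
  | empty => rw [slice_empty]; exact .empty
  | compl S _ ih => rw [slice_compl]; exact huniv.diff ih
  | iUnion f _ ih => rw [slice_iUnion]; exact .iUnion ih

/-- The canonical measure of the induced space. -/
noncomputable def indVol (hV : V.IsLocalSpace) (η : Measure G) : Measure (Δ.ind V).carrier :=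
  Measure.ofMeasurable (fun K _ => ∑' w, η (Δ.slice w K)) (by simp [slice_empty])
    (fun K hK hd => by
      rw [ENNReal.tsum_comm]
      refine tsum_congr fun w => ?_
      rw [slice_iUnion, measure_iUnion (fun i j hij => Δ.disjoint_slice w (hd hij))
        fun i => Δ.measurableSet_slice hV w (hK i)])

theorem indVol_apply (hV : V.IsLocalSpace) (η : Measure G) {K : Set (Δ.ind V).carrier}
    (hK : MeasurableSet K) : Δ.indVol hV η K = ∑' w, η (Δ.slice w K) :=
  Measure.ofMeasurable_apply K hK

/-- Cut `A = {g ∈ O | p.g ∈ K}` by the value `γ` of the cocycle. Left translation carries the piece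
for `γ` to `B γ ⊆ Δ`, and the slice of `K` over `w` is the disjoint union of those `B γ` with `p.1.γ
= w`. Left invariance and an exchange of sums give the formula. The chart `O` is arbitrary; it need
not be good. -/
theorem isCanonicalMeasure_indVol (hV : V.IsLocalSpace) (η : Measure G) [η.IsMulLeftInvariant] :
    (Δ.ind V).IsCanonicalMeasure η (Δ.indVol hV η) := by
  intro p O hO K hK hKO
  have := Γ.countable_of_discreteTopology
  obtain ⟨hOo, -, hdom, he, -⟩ := hO
  set d := Δ.sec (Δ.toProd p).2 with hd
  set A := {g | g ∈ O ∧ ∃ q ∈ K, q ∈ (Δ.ind V).act (p, g)} with hAdef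
  have hA : MeasurableSet A := by
    have h1 : A = Subtype.val '' ((fun g : O => ((Δ.ind V).act (p, (g : G))).get
        (hdom g g.2)) ⁻¹' K) := by
      ext g
      constructor
      · rintro ⟨hg, q, hq, hqg⟩
        refine ⟨⟨g, hg⟩, ?_, rfl⟩
        rwa [mem_preimage, Part.get_eq_of_mem hqg]
      · rintro ⟨⟨g, hg⟩, h, rfl⟩
        exact ⟨hg, _, h, Part.get_mem _⟩
    rw [h1]
    exact hOo.measurableSet.subtype_image (he.continuous.measurable hK)
  have hinj : ∀ g ∈ A, ∀ h ∈ A, ∀ q, q ∈ (Δ.ind V).act (p, g) → q ∈ (Δ.ind V).act (p, h) →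
      g = h := fun g hg h hh q hq hq' => congrArg Subtype.val (he.injective (a₁ := ⟨g, hg.1⟩)
        (a₂ := ⟨h, hh.1⟩) ((Part.get_eq_of_mem hq _).trans (Part.get_eq_of_mem hq' _).symm))
  let B : Γ → Set G := fun γ => Δ.carrier ∩ (fun e => d⁻¹ * γ * e) ⁻¹' A
  have hB : ∀ γ, MeasurableSet (B γ) := fun γ =>
    Δ.measurableSet_carrier.inter (measurable_const_mul _ hA)
  have hBq : ∀ γ, ∀ e ∈ B γ, ∃ q ∈ K, q ∈ (Δ.ind V).act (p, d⁻¹ * γ * e) ∧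
      (Δ.toProd q).1 ∈ V.act ((Δ.toProd p).1, γ) ∧ (Δ.toProd q).2 = RightCosets.mk e := by
    rintro γ e ⟨he, -, q, hq, hqg⟩
    have h1 := Δ.cocycle_eq_of_mul_eq (x := (Δ.toProd p).2) (g := d⁻¹ * γ * e) (γ := γ) he
      (by simp [mul_assoc, hd])
    have h2 := Δ.mem_preAct.mp (Δ.mem_ind_act.mp hqg).2
    refine ⟨q, hq, hqg, by rw [← h1.1]; exact h2.1, ?_⟩
    exact h2.2.trans ((Δ.mk_sec _).symm.trans (congrArg RightCosets.mk h1.2))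
  have hA' : A = ⋃ γ : Γ, (fun g => (γ : G)⁻¹ * d * g) ⁻¹' B γ := by
    ext g
    simp only [mem_iUnion]
    constructor
    · intro hg
      have h1 := Δ.sec_mul (Δ.toProd p).2 g
      refine ⟨Δ.cocycle (Δ.toProd p).2 g, ?_, ?_⟩
      · change (Δ.cocycle (Δ.toProd p).2 g : G)⁻¹ * d * g ∈ Δ.carrier
        rw [mul_assoc, h1, inv_mul_cancel_left]
        exact Δ.sec_mem _
      · simpa [mul_assoc] using hg
    · rintro ⟨γ, -, hg⟩
      simpa [mul_assoc] using hg
  have hηA : η A = ∑' γ, η (B γ) := by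
    rw [hA', measure_iUnion]
    · exact tsum_congr fun γ => measure_preimage_mul η _ _
    · intro γ γ' hne
      refine disjoint_left.mpr fun g hg hg' => hne ?_
      have h1 := Δ.eq_one_of_mul_mem (γ := γ⁻¹ * γ') hg'.1 hg.1 (by simp [mul_assoc])
      exact inv_mul_eq_one.mp h1
    · exact fun γ => measurable_const_mul _ (hB γ)
  let C : V.carrier → Γ → Set G := fun w γ => {e | e ∈ B γ ∧ w ∈ V.act ((Δ.toProd p).1, γ)}
  have hC : ∀ w γ, MeasurableSet (C w γ) := fun w γ => (hB γ).inter (.const _)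
  have hslice : ∀ w, Δ.slice w K = ⋃ γ, C w γ := fun w => by
    ext e
    simp only [mem_iUnion]
    constructor
    · rintro ⟨he, m, hm, hme⟩
      obtain ⟨g, hg, hmg⟩ := hKO m hm
      have h2 := Δ.mem_preAct.mp (Δ.mem_ind_act.mp hmg).2
      rw [hme] at h2
      refine ⟨_, ⟨he, ?_⟩, h2.1⟩
      have h3 : RightCosets.mk e = (Δ.toProd p).2.mul g := h2.2
      have : d⁻¹ * Δ.cocycle (Δ.toProd p).2 g * e = g := by
        rw [mul_assoc, ← Δ.sec_mk he, h3, ← Δ.sec_mul, inv_mul_cancel_left]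
      rw [mem_preimage, this]
      exact ⟨hg, m, hm, hmg⟩
    · rintro ⟨γ, heB, hw⟩
      obtain ⟨q, hq, -, h1, h2⟩ := hBq γ e heB
      exact ⟨heB.1, q, hq, Prod.ext (Part.mem_unique h1 hw) h2⟩
  have hηs : ∀ w, η (Δ.slice w K) = ∑' γ, η (C w γ) := fun w => by
    rw [hslice, measure_iUnion _ (hC w)]
    -- A common `e` gives the same point of `K` from two elements of the chart domain; injectivity
    -- of the chart yields `γ = γ'`.
    intro γ γ' hne
    refine disjoint_left.mpr fun e he he' => hne ?_
    obtain ⟨q, hq, h1, h2, h3⟩ := hBq γ e he.1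
    obtain ⟨q', hq', h1', h2', h3'⟩ := hBq γ' e he'.1
    have hqq : q = q' := Δ.toProd_injective (Prod.ext
      ((Part.mem_unique h2 he.2).trans (Part.mem_unique h2' he'.2).symm) (h3.trans h3'.symm))
    subst hqq
    have := hinj _ he.1.2 _ he'.1.2 q h1 h1'
    exact Subtype.ext (mul_left_cancel (mul_right_cancel this))
  -- If `B γ` is nonempty, `p.1.γ` is defined and exactly one `w` contributes; otherwise both sides
  -- vanish.
  have hsum : ∀ γ, ∑' w, η (C w γ) = η (B γ) := fun γ => by
    rcases (B γ).eq_empty_or_nonempty with h | ⟨e, he⟩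
    · have : ∀ w, C w γ = ∅ := fun w => eq_empty_of_forall_notMem fun e he => by
        have h1 : e ∈ B γ := he.1
        rw [h] at h1
        exact h1
      simp [this, h]
    · obtain ⟨q, -, -, h2, -⟩ := hBq γ e he
      rw [tsum_eq_single (Δ.toProd q).1]
      · congr 1
        ext e
        exact ⟨fun h => h.1, fun h => ⟨h, h2⟩⟩
      · intro w hw
        have : C w γ = ∅ := eq_empty_of_forall_notMem fun e he => hw (Part.mem_unique he.2 h2)
        rw [this, measure_empty]
  rw [Δ.indVol_apply hV η hK, hηA]
  simp_rw [hηs]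
  rw [ENNReal.tsum_comm]
  exact tsum_congr hsum

theorem indVol_univ_le [Fintype V.carrier] (hV : V.IsLocalSpace) (η : Measure G) :
    Δ.indVol hV η univ ≤ Fintype.card V.carrier * η Δ.carrier := by
  rw [Δ.indVol_apply hV η .univ, tsum_fintype]
  exact (Finset.sum_le_card_nsmul _ _ _ fun w _ => measure_mono (Δ.slice_subset w _)).trans
    (by simp)

theorem le_indVol [Fintype V.carrier] (hV : V.IsLocalSpace) (η : Measure G)
    {S : Finset V.carrier} {D : Set G} {K : Set (Δ.ind V).carrier}
    (hD : ∀ w ∈ S, D ⊆ Δ.slice w K) : S.card * η D ≤ Δ.indVol hV η K := by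
  -- `K` will be a set of good points, whose measurability is not established; the measurable hull
  -- has the same measure.
  rw [← measure_toMeasurable K, Δ.indVol_apply hV η (measurableSet_toMeasurable _ _), tsum_fintype]
  refine le_trans ?_ (Finset.sum_le_univ_sum_of_nonneg (s := S) fun _ => zero_le)
  rw [← nsmul_eq_mul]
  refine Finset.card_nsmul_le_sum _ _ _ fun w hw => measure_mono fun e he => ?_
  obtain ⟨h1, m, hm, h2⟩ := hD w hw he
  exact ⟨h1, m, subset_toMeasurable _ _ hm, h2⟩

end FundamentalDomain

/-! ### Sofic approximations to a discrete group. -/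

namespace PartialSpace

/-- A sofic approximation to a discrete group is a finite set, on which the canonical measure is a
multiple of the counting measure. -/
theorem IsSoficApprox.finite_and_card_le {G : Type u} [Group G] [TopologicalSpace G]
    [DiscreteTopology G] {V : PartialSpace.{u, v} G} {W : Set G} {ε : ℝ}
    (h : V.IsSoficApprox W ε) : Finite V.carrier ∧
      ENNReal.ofReal (1 - ε) * Nat.card V.carrier ≤ (V.goodPoints W).ncard := by
  obtain ⟨hV, η, vol, hη, hvol, hfin, hle⟩ := h
  have := hV.discreteTopology
  have := hV.countable
  let _ : MeasurableSpace G := borel G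
  have : BorelSpace G := ⟨rfl⟩
  let _ : MeasurableSpace V.carrier := borel V.carrier
  have : BorelSpace V.carrier := ⟨rfl⟩
  have hη0 : η {1} ≠ 0 := ((isOpen_discrete {(1 : G)}).measure_pos η ⟨1, rfl⟩).ne'
  have hη1 : η {1} ≠ ⊤ := (isCompact_singleton.measure_lt_top (μ := η)).ne
  -- `{1}` is a chart range at every point, so every singleton has measure `η {1}`, which is
  -- positive and finite.
  have hchart : ∀ p, V.IsChart p {1} := fun p => by
    refine ⟨isOpen_discrete _, rfl, ?_⟩
    have hd : ∀ g ∈ ({1} : Set G), (V.act (p, g)).Dom := by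
      rintro g rfl
      exact Part.dom_iff_mem.mpr ⟨p, hV.one_act p⟩
    exact ⟨hd, .of_continuous_injective_isOpenMap continuous_of_discreteTopology
      (Function.injective_of_subsingleton _) (fun _ _ => isOpen_discrete _),
      ⟨1, rfl⟩, Part.get_eq_of_mem (hV.one_act p) _⟩
  have hvol1 : vol = η {1} • Measure.count := Measure.ext_of_singleton fun p => by
    rw [hvol p {1} (hchart p) {p} (MeasurableSet.singleton p)
      (by rintro q rfl; exact ⟨1, rfl, hV.one_act q⟩)]
    have : {g | g ∈ ({1} : Set G) ∧ ∃ q ∈ ({p} : Set V.carrier), q ∈ V.act (p, g)} = {1} := by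
      ext g
      refine ⟨fun h => h.1, ?_⟩
      rintro rfl
      exact ⟨rfl, p, rfl, hV.one_act p⟩
    rw [this]
    simp
  rw [hvol1] at hfin hle
  have hfin' : Finite V.carrier := by
    rw [Measure.smul_apply, smul_eq_mul] at hfin
    have h1 : Measure.count (univ : Set V.carrier) < ⊤ := by
      by_contra h
      rw [not_lt_top_iff] at h
      rw [h, ENNReal.mul_top hη0] at hfin
      exact lt_irrefl _ hfin
    exact finite_univ_iff.mp (Measure.count_apply_lt_top.mp h1)
  refine ⟨hfin', ?_⟩
  have hcount : ∀ A : Set V.carrier, Measure.count A = (A.ncard : ENNReal) := fun A => by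
    rw [Measure.count_apply_finite A A.toFinite, ncard_eq_toFinset_card A A.toFinite]
  rw [Measure.smul_apply, Measure.smul_apply, hcount, hcount, smul_eq_mul, smul_eq_mul,
    mul_left_comm, ncard_univ] at hle
  exact (ENNReal.mul_le_mul_iff_right hη0 hη1).mp hle

end PartialSpace

/-! ### The proportion of good points in one induced space. -/

namespace FundamentalDomain

variable {G : Type u} [Group G] [TopologicalSpace G] {Γ : Subgroup G}
  (Δ : FundamentalDomain Γ) {V : PartialSpace.{u, v} Γ}

/-- `F` contains every cocycle value `c(u) = c(Γd, u)`, and `a⁻¹b` acts at `d.a` by `c(a)⁻¹c(b) ∈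
F⁻¹F`, so all that goodness requires happens inside `W`. For injectivity, the `V`-coordinate
determines `c(u)`, the coset determines `σ(Γdu)`, and `d u` is their product. -/
theorem isGood_of_mem_goodPoints {v : V.carrier} {W : Set Γ} (hv : v ∈ V.goodPoints W) {d : G}
    (hd : d ∈ Δ.carrier) {U : Set G} (hU : IsOpen U) (h1 : (1 : G) ∈ U) {F : Set Γ}
    (hF : ∀ γ : Γ, ∀ u ∈ U, d * u ∈ (γ : G) • Δ.carrier → γ ∈ F) (hFW : F ⊆ W)
    (hFFW : F⁻¹ * F ⊆ W) : Δ.IsGood V (v, RightCosets.mk d) U := by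
  have hc : ∀ u ∈ U, Δ.cocycle (RightCosets.mk d) u ∈ F := fun u hu => by
    refine hF _ u hu ⟨_, Δ.sec_mem ((RightCosets.mk d).mul u), ?_⟩
    change (Δ.cocycle (RightCosets.mk d) u : G) * Δ.sec ((RightCosets.mk d).mul u) = d * u
    rw [← Δ.sec_mul, Δ.sec_mk hd]
  refine ⟨hU, h1, fun a ha b hb => ?_, fun a ha b hb q hqa hqb => ?_⟩
  · have hab := hFFW (mul_mem_mul (Set.inv_mem_inv.mpr (hc a ha)) (hc b hb))
    obtain ⟨q, r, hq, hr, -⟩ := hv.1 _ _ (hFW (hc a ha)) hab (by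
      rw [mul_inv_cancel_left]
      exact hFW (hc b hb))
    refine ⟨(q, (RightCosets.mk d).mul a), Δ.mem_preAct.mpr ⟨hq, rfl⟩, ?_⟩
    refine Part.dom_iff_mem.mpr ⟨(r, (RightCosets.mk d).mul b), Δ.mem_preAct.mpr ⟨?_, ?_⟩⟩
    · have : Δ.cocycle ((RightCosets.mk d).mul a) (a⁻¹ * b) =
          (Δ.cocycle (RightCosets.mk d) a)⁻¹ * Δ.cocycle (RightCosets.mk d) b := by
        rw [eq_inv_mul_iff_mul_eq, ← cocycle_mul, mul_inv_cancel_left]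
      change r ∈ V.act (q, Δ.cocycle ((RightCosets.mk d).mul a) (a⁻¹ * b))
      rwa [this]
    · exact (by rw [RightCosets.mul_mul, mul_inv_cancel_left])
  · obtain ⟨hdom, he, -⟩ := hv.2
    rw [mem_preAct] at hqa hqb
    have h2 : Δ.cocycle (RightCosets.mk d) a = Δ.cocycle (RightCosets.mk d) b :=
      congrArg Subtype.val (he.injective (a₁ := ⟨_, hFW (hc a ha)⟩) (a₂ := ⟨_, hFW (hc b hb)⟩)
        ((Part.get_eq_of_mem hqa.1 _).trans (Part.get_eq_of_mem hqb.1 _).symm))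
    have h3 : (RightCosets.mk d : RightCosets Γ).mul a = (RightCosets.mk d).mul b :=
      hqa.2.symm.trans hqb.2
    refine mul_left_cancel (a := Δ.sec (RightCosets.mk d)) ?_
    rw [Δ.sec_mul, Δ.sec_mul, h2, h3]

/-- This is where local finiteness of the fundamental domain enters: it makes `F`, and hence `F⁻¹F`,
finite. -/
theorem finite_translates_of_isLocallyFinite [IsTopologicalGroup G] (hΔ : Δ.IsLocallyFinite)
    {K L : Set G} (hK : IsCompact K) (hL : IsCompact L) :
    {γ : Γ | ∃ d ∈ K, ∃ u ∈ L, d * u ∈ (γ : G) • Δ.carrier}.Finite := by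
  refine (LocallyFinite.finite_nonempty_inter_compact hΔ (hK.mul hL)).subset ?_
  rintro γ ⟨d, hd, u, hu, h⟩
  exact ⟨_, h, mul_mem_mul hd hu⟩

variable [IsTopologicalGroup G] [T2Space G] [LocallyCompactSpace G] [SecondCountableTopology G]

theorem isSoficApprox_ind_of_le [DiscreteTopology Γ] (hΓ : IsLatticeSubgroup Γ) {W : Set Γ} {ε ε' : ℝ}
    (hV : V.IsSoficApprox W ε) {U : Set G}
    (h : ∀ [MeasurableSpace G] [BorelSpace G] (η : Measure G) [η.IsHaarMeasure]
      [MeasurableSpace (Δ.ind V).carrier] [BorelSpace (Δ.ind V).carrier],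
      ENNReal.ofReal (1 - ε') * (Nat.card V.carrier * η Δ.carrier) ≤
        Δ.indVol hV.1 η ((Δ.ind V).goodPoints U)) :
    (Δ.ind V).IsSoficApprox U ε' := by
  have := hV.finite_and_card_le.1
  have := Fintype.ofFinite V.carrier
  let _ : MeasurableSpace G := borel G
  have : BorelSpace G := ⟨rfl⟩
  let _ : MeasurableSpace (Δ.ind V).carrier := borel _
  have : BorelSpace (Δ.ind V).carrier := ⟨rfl⟩
  have hle := Δ.indVol_univ_le hV.1 Measure.haar
  rw [← Nat.card_eq_fintype_card] at hle
  refine ⟨Δ.isLocalSpace_ind hV.1, Measure.haar, Δ.indVol hV.1 Measure.haar, inferInstance,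
    Δ.isCanonicalMeasure_indVol hV.1 _, hle.trans_lt ?_, ?_⟩
  · exact ENNReal.mul_lt_top (by simp) (Δ.measure_carrier_lt_top hΓ _)
  · exact (mul_le_mul_right hle _).trans (h _)

theorem isSoficApprox_ind_of_one_le (hΓ : IsLatticeSubgroup Γ) {W : Set Γ} {ε ε' : ℝ}
    (hV : V.IsSoficApprox W ε) (U : Set G) (hε' : 1 ≤ ε') : (Δ.ind V).IsSoficApprox U ε' := by
  have := hΓ.discrete
  refine Δ.isSoficApprox_ind_of_le hΓ hV ?_
  intros
  rw [ENNReal.ofReal_of_nonpos (by linarith), zero_mul]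
  exact zero_le

/-- Each `w ∈ V[W]` contributes good points `(w, Γd)` for all `d ∈ D`, hence volume at least `η D`,
against a total of at most `|V| η(Δ)`. -/
theorem isSoficApprox_ind (hΓ : IsLatticeSubgroup Γ) {W : Set Γ} {ε δ : ℝ}
    (hV : V.IsSoficApprox W ε) (hε : 0 ≤ ε) (hδ : 0 ≤ δ) {U : Set G} (hU : IsOpen U)
    (h1 : (1 : G) ∈ U) {D : Set G} (hD : D ⊆ Δ.carrier) {F : Set Γ}
    (hF : ∀ γ : Γ, ∀ d ∈ D, ∀ u ∈ U, d * u ∈ (γ : G) • Δ.carrier → γ ∈ F) (hFW : F ⊆ W)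
    (hFFW : F⁻¹ * F ⊆ W)
    (hηD : ∀ [MeasurableSpace G] [BorelSpace G] (η : Measure G) [η.IsHaarMeasure],
      ENNReal.ofReal (1 - δ) * η Δ.carrier ≤ η D) :
    (Δ.ind V).IsSoficApprox U (ε + δ) := by
  -- For `ε + δ ≥ 1` the bound is vacuous; otherwise `1 - ε ≥ 0`, so that `ofReal` splits the
  -- product `(1 - ε)(1 - δ) ≥ 1 - (ε + δ)`.
  rcases le_or_gt 1 (ε + δ) with hle | hlt
  · exact Δ.isSoficApprox_ind_of_one_le hΓ hV U hle
  have := hΓ.discrete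
  obtain ⟨hfin, hcard⟩ := hV.finite_and_card_le
  have := Fintype.ofFinite V.carrier
  refine Δ.isSoficApprox_ind_of_le hΓ hV ?_
  intro _ _ η _ _ _
  have key := Δ.le_indVol hV.1 η (S := (V.goodPoints W).toFinite.toFinset) (D := D)
    (K := (Δ.ind V).goodPoints U) fun w hw e he => by
      have hg := Δ.isGood_of_mem_goodPoints (by simpa using hw) (hD he) hU h1
        (fun γ u hu => hF γ e he u hu) hFW hFFW
      exact ⟨hD he, ⟨_, U, hg⟩, Δ.mem_goodPoints_of_isGood hV.1 (m := ⟨_, U, hg⟩) hg, rfl⟩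
  rw [← ncard_eq_toFinset_card] at key
  refine le_trans ?_ key
  calc ENNReal.ofReal (1 - (ε + δ)) * (Nat.card V.carrier * η Δ.carrier)
      ≤ ENNReal.ofReal ((1 - ε) * (1 - δ)) * (Nat.card V.carrier * η Δ.carrier) := by
        gcongr
        nlinarith [mul_nonneg hε hδ]
    _ = (ENNReal.ofReal (1 - ε) * Nat.card V.carrier) *
          (ENNReal.ofReal (1 - δ) * η Δ.carrier) := by
        rw [ENNReal.ofReal_mul (by linarith)]
        ring
    _ ≤ _ := by
        gcongr
        exact hηD η

omit [T2Space G] in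
theorem measure_carrier_pos [DiscreteTopology Γ] [MeasurableSpace G] [BorelSpace G] (η : Measure G)
    [η.IsHaarMeasure] : 0 < η Δ.carrier := by
  have := Γ.countable_of_discreteTopology
  refine pos_iff_ne_zero.mpr fun h => ?_
  have h1 : η univ = 0 := by
    rw [← Δ.cover, measure_iUnion_null_iff]
    exact fun γ => by rw [measure_smul, h]
  exact (isOpen_univ.measure_pos η univ_nonempty).ne' h1

/-- Up to an arbitrarily small proportion, the fundamental domain is relatively compact. -/
theorem exists_isCompact_le_measure (hΓ : IsLatticeSubgroup Γ) {δ : ℝ} (hδ : 0 < δ) :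
    ∃ K : Set G, IsCompact K ∧
      ∀ [MeasurableSpace G] [BorelSpace G] (η : Measure G) [η.IsHaarMeasure],
        ENNReal.ofReal (1 - δ) * η Δ.carrier ≤ η (Δ.carrier ∩ K) := by
  have := hΓ.discrete
  let E := CompactExhaustion.choice G
  let _ : MeasurableSpace G := borel G
  have : BorelSpace G := ⟨rfl⟩
  have hlt : ENNReal.ofReal (1 - δ) * (Measure.haar : Measure G) Δ.carrier <
      (Measure.haar : Measure G) Δ.carrier := by
    nth_rewrite 2 [← one_mul ((Measure.haar : Measure G) Δ.carrier)]
    refine (ENNReal.mul_lt_mul_iff_left (Δ.measure_carrier_pos _).ne'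
      (Δ.measure_carrier_lt_top hΓ _).ne).mpr ?_
    rw [ENNReal.ofReal_lt_one]
    linarith
  have ht : Tendsto (fun n => (Measure.haar : Measure G) (Δ.carrier ∩ E n)) atTop
      (𝓝 ((Measure.haar : Measure G) Δ.carrier)) := by
    have := tendsto_measure_iUnion_atTop (μ := (Measure.haar : Measure G))
      (s := fun n => Δ.carrier ∩ E n) fun i j hij => inter_subset_inter_right _ (E.subset hij)
    rwa [← inter_iUnion, E.iUnion_eq, inter_univ] at this
  obtain ⟨n, hn⟩ := (ht.eventually (lt_mem_nhds hlt)).exists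
  refine ⟨E n, E.isCompact n, ?_⟩
  intro inst hb η _
  obtain rfl : inst = borel G := hb.measurable_eq
  -- By uniqueness of Haar measure, the `K` found for one normalization serves all.
  rw [Measure.isMulLeftInvariant_eq_smul η Measure.haar, Measure.smul_apply, Measure.smul_apply,
    mul_smul_comm]
  exact smul_le_smul_of_nonneg_left hn.le zero_le

end FundamentalDomain

/-- Take `k i` to be the largest `n ≤ i` whose threshold `N n` is at most `i`. `Nat.findGreatest`
returns `0` when there is none, hence the exception. -/
theorem exists_monotone_tendsto_forall {P : ℕ → ℕ → Prop} (h : ∀ n, ∀ᶠ i in atTop, P n i) :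
    ∃ k : ℕ → ℕ, Monotone k ∧ Tendsto k atTop atTop ∧ ∀ i, k i ≠ 0 → P (k i) i := by
  simp_rw [eventually_atTop] at h
  choose N hN using h
  classical
  refine ⟨fun i => Nat.findGreatest (fun n => N n ≤ i) i, fun i j hij =>
    Nat.findGreatest_mono (fun n hn => le_trans hn hij) hij, ?_, fun i hi => ?_⟩
  · refine tendsto_atTop.mpr fun b => ?_
    filter_upwards [eventually_ge_atTop (max b (N b))] with i hi
    exact Nat.le_findGreatest ((le_max_left _ _).trans hi) ((le_max_right _ _).trans hi)
  · exact hN _ _ (Nat.findGreatest_of_ne_zero (P := fun n => N n ≤ i) rfl hi)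

/-! ### The induced sequence. -/

namespace FundamentalDomain

variable {G : Type u} [Group G] [TopologicalSpace G] {Γ : Subgroup G}
  (Δ : FundamentalDomain Γ) [IsTopologicalGroup G] [T2Space G] [LocallyCompactSpace G]
  [SecondCountableTopology G]

theorem isSoficApproximation_ind (hΓ : IsLatticeSubgroup Γ) (hΔ : Δ.IsLocallyFinite)
    {V : ℕ → PartialSpace.{u, v} Γ} (hV : IsSoficApproximation V) :
    IsSoficApproximation fun i => Δ.ind (V i) := by
  have := hΓ.discrete
  obtain ⟨hne, W, ε, -, -, hWm, hWu, hε, hεa, hε0, hVs⟩ := hV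
  let E := CompactExhaustion.choice G
  obtain ⟨N, hN⟩ := E.exists_mem 1
  -- The shift by `N + 1` puts `1` in every `U n`, including `U 0`.
  let U : ℕ → Set G := fun n => interior (E (n + (N + 1)))
  have hUm : Monotone U := fun i j hij => interior_mono (E.subset (by omega))
  have hU1 : ∀ n, (1 : G) ∈ U n := fun n =>
    interior_mono (E.subset (by omega)) (E.subset_interior_succ N hN)
  -- `δ 0 = 1`, so indices with `k i = 0`, where `W i` is not under control, have a vacuous bound.
  let δ : ℕ → ℝ := fun n => 1 / ((n : ℝ) + 1)
  have hδ : ∀ n, 0 < δ n := fun n => Nat.one_div_pos_of_nat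
  have hδa : Antitone δ := fun i j hij => Nat.one_div_le_one_div hij
  choose K hK hηK using fun n => Δ.exists_isCompact_le_measure hΓ (hδ n)
  let F : ℕ → Set Γ := fun n =>
    {γ | ∃ d ∈ K n, ∃ u ∈ E (n + (N + 1)), d * u ∈ (γ : G) • Δ.carrier}
  have hF : ∀ n, (F n).Finite := fun n =>
    Δ.finite_translates_of_isLocallyFinite hΔ (hK n) (E.isCompact _)
  have hFW : ∀ n, ∀ᶠ i in atTop, F n ∪ (F n)⁻¹ * F n ⊆ W i := fun n => by
    have hfin : (F n ∪ (F n)⁻¹ * F n).Finite := (hF n).union ((hF n).inv.mul (hF n))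
    refine ((eventually_all_finite hfin).mpr fun γ _ => ?_).mono fun i hi γ hγ => hi γ hγ
    obtain ⟨i, hi⟩ := mem_iUnion.mp (hWu ▸ mem_univ γ : γ ∈ ⋃ i, W i)
    exact (eventually_ge_atTop i).mono fun j hj => hWm hj hi
  obtain ⟨k, hkm, hkt, hk⟩ := exists_monotone_tendsto_forall hFW
  refine ⟨?_, fun i => U (k i), fun i => ε i + δ (k i), fun i => isOpen_interior, fun i => ?_,
    hUm.comp hkm, ?_, fun i => add_pos (hε i) (hδ _), hεa.add (hδa.comp_monotone hkm), ?_,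
    fun i => ?_⟩
  -- Once `ε i < 1` and `δ (k i) < 1`, both `V i` and `Δ ∩ K (k i)` supply a point, and the pair has
  -- a good set.
  · filter_upwards [hne, hkt.eventually_gt_atTop 0, hε0.eventually (gt_mem_nhds one_pos)]
      with i ⟨p⟩ hki hεi
    obtain ⟨hfin, hcard⟩ := (hVs i).finite_and_card_le
    have h1 : ((V i).goodPoints (W i)).Nonempty := by
      rw [nonempty_iff_ne_empty]
      intro h
      have : Nonempty (V i).carrier := ⟨p⟩
      rw [h, ncard_empty, Nat.cast_zero, le_zero_iff, mul_eq_zero, ENNReal.ofReal_eq_zero,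
        Nat.cast_eq_zero] at hcard
      rcases hcard with h | h
      · linarith
      · exact Nat.card_pos.ne' h
    obtain ⟨w, hw⟩ := h1
    have h2 : (Δ.carrier ∩ K (k i)).Nonempty := by
      let _ : MeasurableSpace G := borel G
      have : BorelSpace G := ⟨rfl⟩
      refine nonempty_of_measure_ne_zero (μ := Measure.haar)
        (lt_of_lt_of_le (ENNReal.mul_pos ?_ (Δ.measure_carrier_pos _).ne') (hηK _ _)).ne'
      rw [Ne, ENNReal.ofReal_eq_zero, not_le, sub_pos, div_lt_one (by positivity)]
      have : (0 : ℝ) < k i := by exact_mod_cast hki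
      linarith
    obtain ⟨d, hd, hdK⟩ := h2
    have hFi := hk i hki.ne'
    exact ⟨⟨_, U (k i), Δ.isGood_of_mem_goodPoints (F := F (k i)) hw hd isOpen_interior (hU1 _)
      (fun γ u hu h => ⟨d, hdK, u, interior_subset hu, h⟩)
      (subset_union_left.trans hFi) (subset_union_right.trans hFi)⟩⟩
  · exact (E.isCompact _).closure_of_subset interior_subset
  · refine eq_univ_of_forall fun g => ?_
    obtain ⟨n, hn⟩ := E.exists_mem g
    obtain ⟨i, hi⟩ := (hkt.eventually_ge_atTop n).exists
    exact mem_iUnion.mpr ⟨i, interior_mono (E.subset (by omega)) (E.subset_interior_succ n hn)⟩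
  · have h1 : Tendsto δ atTop (𝓝 0) := tendsto_one_div_add_atTop_nhds_zero_nat
    simpa using hε0.add (h1.comp hkt)
  · rcases eq_or_ne (k i) 0 with h | h
    · refine Δ.isSoficApprox_ind_of_one_le hΓ (hVs i) _ ?_
      have : δ (k i) = 1 := by simp [δ, h]
      linarith [hε i]
    · have hFi := hk i h
      exact Δ.isSoficApprox_ind (F := F (k i)) hΓ (hVs i) (hε i).le (hδ _).le isOpen_interior (hU1 _)
        inter_subset_left (fun γ d hd u hu h => ⟨d, hd.2, u, interior_subset hu, h⟩)
        (subset_union_left.trans hFi) (subset_union_right.trans hFi) (hηK (k i))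

end FundamentalDomain

theorem theoremT {G : Type u} [Group G] [TopologicalSpace G] [IsTopologicalGroup G]
    [T2Space G] [LocallyCompactSpace G] [SecondCountableTopology G]
    (Γ : Subgroup G) (hΓ : IsLatticeSubgroup Γ) :
    (IsSofic Γ → IsSofic G) ∧
      (∃ Δ : FundamentalDomain Γ, Δ.IsLocallyFinite) ∧
      ∀ V : ℕ → PartialSpace.{u, v} Γ, IsSoficApproximation V →
        ∀ Δ : FundamentalDomain Γ, Δ.IsLocallyFinite →
          IsSoficApproximation fun i => Δ.ind (V i) := by
  have := hΓ.discrete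
  obtain ⟨Δ, hΔ⟩ := FundamentalDomain.exists_isLocallyFinite Γ
  refine ⟨fun ⟨V, hV⟩ => ⟨_, Δ.isSoficApproximation_ind hΓ hΔ hV⟩, ⟨Δ, hΔ⟩,
    fun V hV Δ hΔ => Δ.isSoficApproximation_ind hΓ hΔ hV⟩
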